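/- Let $(X,d)$ be a complete metric space, $u^\ast\in X$, and for every $\varepsilon>0$ let $\phi_\varepsilon\colon X\to(-\infty,+\infty]$ be such that (i) every $\phi_\varepsilon$ is lower semicontinuous; (ii) there exist $C^\ast\in\mathbb R$ and $\tau^\ast>0$ with $\phi_\varepsilon(v)+\frac1{2\tau^\ast}d^2(v,u^\ast)\ge C^\ast$ for all $v\in X$ and all $\varepsilon>0$; (iii) for every $C>0$ there is a compact set $K\subset X$ with $\{v: d^2(v,u^\ast)\le C,\ |\phi_\varepsilon(v)|\le C\}\subset K$ for all $\varepsilon>0$. For $\phi\colon X\to(-\infty,+\infty]$ the (descending) slope is $|\partial\phi|(x)=\limsup_{y\to x}\frac{(\phi(x)-\phi(y))^+}{d(x,y)}$ if $\phi(x)<+\infty$ and $x$ is not isolated, $0$ if $\phi(x)<+\infty$ and $x$ is isolated, and $+\infty$ if $\phi(x)=+\infty$. A curve $u\colon[0,T]\to X$ is in $AC^2([0,T];X)$ if there is $A\in L^2(0,T)$ with $d(u(s),u(t))\le\int_s^tA\,dr$ for $0\le s\le t\le T$; the (a.e.) smallest such $A$ is the metric derivative $|u'|$. A curve of maximal slope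 for $\phi$ in $[0,T]$ is $u\in AC^2([0,T];X)$ for which there is a non-increasing $\varphi\colon[0,T]\to\mathbb R$ with $\varphi=\phi\circ u$ a.e. in $[0,T]$ and $$\varphi(s)-\varphi(t)\ge\frac12\int_s^t|u'|^2(r)\,dr+\frac12\int_s^t|\partial\phi|^2(u(r))\,dr\qquad\text{for all }0\le s\le t\le T.$$ Given $\tau_\varepsilon>0$ with $\tau_\varepsilon\to0$ as $\varepsilon\to0^+$ and $u^0_\varepsilon\in X$, let (for all small $\varepsilon>0$) $u_\varepsilon^{i+1}$ be, recursively, a minimizer over $X$ of $v\mapsto\phi_\varepsilon(v)+\frac1{2\tau_\varepsilon}d^2(v,u^i_\varepsilon)$, and set $\overline u_\varepsilon(0)=u_\varepsilon^0$, $\overline u_\varepsilon(t)=u_\varepsilon^{i+1}$ for $t\in(i\tau_\varepsilon,(i+1)\tau_\varepsilon]$. A minimizing movement along $\phi_\varepsilon$ at scale $\tau_\varepsilon$ with initial data $u^0_\varepsilon$ is any pointwise limit $u\colon[0,+\infty)\to X$ of such a family $\overline u_\varepsilon$ along a sequence $\varepsilon_n\to0^+$. Suppose that $\phi_\varepsilon$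 $\Gamma$-converges to $\phi_0$ with respect to $d$ as $\varepsilon\to0^+$ and that each $\phi_\varepsilon$ has the Slope Cone Property: for every $x$ such that $\phi_\varepsilon(x)$ and $|\partial\phi_\varepsilon|(x)$ are finite, $$\phi_\varepsilon(y)\ge\phi_\varepsilon(x)-d(x,y)\,|\partial\phi_\varepsilon|(x)\qquad\text{for all }y\in X.$$ Let $u^0_\varepsilon\in X$ satisfy $d^2(u^0_\varepsilon,u^\ast)\le S'<+\infty$ and $|\phi_\varepsilon(u^0_\varepsilon)|\le S<+\infty$ for all $\varepsilon>0$. Then, for all families $\tau_\varepsilon>0$ with $\tau_\varepsilon\to0$, every minimizing movement along $\phi_\varepsilon$ at scale $\tau_\varepsilon$ with initial data $u^0_\varepsilon$ is a curve of maximal slope for $\phi_0$ in $[0,T]$, for every $T>0$. Moreover, this applies to convex $\phi_\varepsilon$: if $\psi\colon X\to(-\infty,+\infty]$ is convex, in the sense that any two points $x,y$ with $\psi(x),\psi(y)<+\infty$ are joined by a constant-speed geodesic $\gamma\colon[0,1]\to X$, $\gamma(0)=x$, $\gamma(1)=y$, with $\psi(\gamma(t))\le(1-t)\psi(x)+t\psi(y)$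 for $t\in[0,1]$ (as for usual convex functions on a Banach space, with $\gamma$ the segment), then $\psi$ has the Slope Cone Property. -/

import Mathlib

open Filter Topology MeasureTheory Set
open scoped ENNReal

/-- `v` minimizes `w ↦ φ w + d(w, p)² / (2 τ)` over the whole space. -/
def IsProxStep {X : Type*} [MetricSpace X] (φ : X → EReal) (τ : ℝ) (p v : X) : Prop :=
  ∀ w : X, φ v + ((dist v p ^ 2 / (2 * τ) : ℝ) : EReal)
    ≤ φ w + ((dist w p ^ 2 / (2 * τ) : ℝ) : EReal)

/-- A sequence of successive minimizers with time step `τ`, started at `p`. -/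
def IsDiscreteSolution {X : Type*} [MetricSpace X] (φ : X → EReal) (τ : ℝ) (p : X)
    (w : ℕ → X) : Prop :=
  w 0 = p ∧ ∀ i : ℕ, IsProxStep φ τ (w i) (w (i + 1))

/-- The piecewise-constant interpolation: value `w (i + 1)` on `(i τ, (i + 1) τ]` and
`w 0` at `t = 0`. -/
noncomputable def piecewiseConst {X : Type*} (τ : ℝ) (w : ℕ → X) (t : ℝ) : X :=
  w ⌈t / τ⌉₊

/-- `u` (on `[0, ∞)`) is a minimizing movement along `φ ε` at scale `τ ε` with initial data
`u₀ ε`: the pointwise limit, along some sequence `ε_n → 0⁺`, of a family of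
piecewise-constant interpolations of discrete solutions.  Discrete solutions are only
required for small `ε`, since the minimum problems need only be solvable for small `τ`. -/
def IsMinimizingMovement {X : Type*} [MetricSpace X] (φ : ℝ → X → EReal) (τ : ℝ → ℝ)
    (u₀ : ℝ → X) (u : ℝ → X) : Prop :=
  ∃ w : ℝ → ℕ → X,
    (∀ᶠ ε in 𝓝[>] (0 : ℝ), IsDiscreteSolution (φ ε) (τ ε) (u₀ ε) (w ε)) ∧
    ∃ e : ℕ → ℝ, (∀ n, 0 < e n) ∧ Tendsto e atTop (𝓝 0) ∧
      ∀ t : ℝ, 0 ≤ t →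
        Tendsto (fun n => piecewiseConst (τ (e n)) (w (e n)) t) atTop (𝓝 (u t))

open Classical in
/-- The descending slope of `φ : X → (-∞, +∞]`.  At an isolated point the punctured
neighbourhood filter is `⊥` and the `limsup` in `[0, ∞]` is `0`; `EReal.toENNReal` is the
positive part. -/
noncomputable def descSlope {X : Type*} [MetricSpace X] (φ : X → EReal) (x : X) : ℝ≥0∞ :=
  if φ x = ⊤ then ⊤
  else limsup (fun y => (φ x - φ y).toENNReal / edist x y) (𝓝[≠] x)

/-- `A ∈ L²(0, T)` and `d(v s, v t) ≤ ∫_s^t A` whenever `0 ≤ s ≤ t ≤ T`. -/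
def IsSpeedBound {X : Type*} [MetricSpace X] (T : ℝ) (v : ℝ → X) (A : ℝ → ℝ) : Prop :=
  MemLp A 2 (volume.restrict (Icc 0 T)) ∧
    ∀ s t : ℝ, 0 ≤ s → s ≤ t → t ≤ T → dist (v s) (v t) ≤ ∫ r in s..t, A r

/-- `v ∈ AC²([0, T]; X)`. -/
def IsAC2 {X : Type*} [MetricSpace X] (T : ℝ) (v : ℝ → X) : Prop :=
  ∃ A : ℝ → ℝ, IsSpeedBound T v A

/-- `A` is the metric derivative of `v` on `[0, T]`: the (a.e.) smallest speed bound. -/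
def IsMetricDerivative {X : Type*} [MetricSpace X] (T : ℝ) (v : ℝ → X) (A : ℝ → ℝ) : Prop :=
  IsSpeedBound T v A ∧
    ∀ B : ℝ → ℝ, IsSpeedBound T v B → A ≤ᵐ[volume.restrict (Icc 0 T)] B

/-- `u` is a curve of maximal slope for `φ` in `[0, T]`; here `m` is the metric derivative
`|u'|` and `ϕ` the non-increasing function that agrees a.e. with `φ ∘ u`.  The integrals are
taken in `[0, ∞]`, so the inequality also says that they are finite. -/
def IsCurveOfMaximalSlope {X : Type*} [MetricSpace X] (φ : X → EReal) (T : ℝ)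
    (u : ℝ → X) : Prop :=
  IsAC2 T u ∧
  ∃ m : ℝ → ℝ, IsMetricDerivative T u m ∧
  ∃ ϕ : ℝ → ℝ, AntitoneOn ϕ (Icc 0 T) ∧
    (∀ s t : ℝ, 0 ≤ s → s ≤ t → t ≤ T →
      (1 / 2) * (∫⁻ r in Icc s t, ENNReal.ofReal (m r ^ 2))
        + (1 / 2) * (∫⁻ r in Icc s t, descSlope φ (u r) ^ 2)
        ≤ ENNReal.ofReal (ϕ s - ϕ t)) ∧
    ∀ᵐ t ∂(volume.restrict (Icc 0 T)), φ (u t) = (ϕ t : EReal)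

/-- `φ ε` Γ-converges to `φ₀` as `ε → 0⁺`, with respect to the distance. -/
def GammaConverges {X : Type*} [MetricSpace X] (φ : ℝ → X → EReal) (φ₀ : X → EReal) : Prop :=
  ∀ e : ℕ → ℝ, (∀ n, 0 < e n) → Tendsto e atTop (𝓝 0) →
    (∀ (x : X) (y : ℕ → X), Tendsto y atTop (𝓝 x) →
      φ₀ x ≤ liminf (fun n => φ (e n) (y n)) atTop) ∧
    (∀ x : X, ∃ y : ℕ → X, Tendsto y atTop (𝓝 x) ∧
      limsup (fun n => φ (e n) (y n)) atTop ≤ φ₀ x)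

/-- The Slope Cone Property. -/
def SlopeConeProperty {X : Type*} [MetricSpace X] (φ : X → EReal) : Prop :=
  ∀ x : X, φ x ≠ ⊤ → descSlope φ x ≠ ⊤ →
    ∀ y : X, φ x - ((dist x y * (descSlope φ x).toReal : ℝ) : EReal) ≤ φ y

/-- Convexity in a metric space: any two points of the domain of `φ` are joined by a
constant-speed geodesic along which `φ` lies below the chord. -/
def IsGeodesicallyConvex {X : Type*} [MetricSpace X] (φ : X → EReal) : Prop :=
  ∀ x y : X, φ x ≠ ⊤ → φ y ≠ ⊤ →
    ∃ γ : ℝ → X, γ 0 = x ∧ γ 1 = y ∧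
      (∀ s ∈ Icc (0 : ℝ) 1, ∀ t ∈ Icc (0 : ℝ) 1, dist (γ s) (γ t) = |s - t| * dist x y) ∧
      ∀ t ∈ Icc (0 : ℝ) 1,
        φ (γ t) ≤ ((1 - t : ℝ) : EReal) * φ x + (t : EReal) * φ y

/-- On a normed space every convex function in the usual sense is convex in the sense of
`IsGeodesicallyConvex`, the geodesics being the segments. -/
theorem isGeodesicallyConvex_of_convex {E : Type*} [NormedAddCommGroup E] [NormedSpace ℝ E]
    (φ : E → EReal)
    (h : ∀ x y : E, φ x ≠ ⊤ → φ y ≠ ⊤ → ∀ t ∈ Icc (0 : ℝ) 1,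
      φ ((1 - t) • x + t • y) ≤ ((1 - t : ℝ) : EReal) * φ x + (t : EReal) * φ y) :
    IsGeodesicallyConvex φ := by
  intro x y hx hy
  refine ⟨fun t => (1 - t) • x + t • y, by simp, by simp, ?_, fun t ht => h x y hx hy t ht⟩
  intro s _ t _
  have : ((1 - s) • x + s • y) - ((1 - t) • x + t • y) = (s - t) • (y - x) := by
    module
  rw [dist_eq_norm, this, norm_smul, Real.norm_eq_abs, dist_comm, dist_eq_norm]

/-! Each minimization step from `p` to `q` is filled in by minimizers `z r` with intermediate time
steps `r ∈ (0, τ]` (De Giorgi's variational interpolation). As `|∂φ_ε|(z r) ≤ d(z r, p) / r`,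
differentiating the minimum value in `r` shows that twice the decrease of the energy pays for the
action of the discrete solution and for the integral of `|∂φ_ε|²` along the interpolation `Z_ε`.
A discrete Gronwall argument bounds the energies from below on `[0, T]`, so by Helly's theorem
energies and actions converge at every time, to `ϕ` and `G`, along a subsequence.

The energy at `Z_ε(t)` is at least the discrete energy, and `Z_ε(t) → u(t)`. Where the `liminf` of
the slopes at `Z_ε(t)` is finite, the Slope Cone Property passes to the `Γ`-limit along recovery
sequences: `φ₀ ≥ ϕ(t) - d(u(t), ·) liminf |∂φ_ε|(Z_ε(t))`. With the `Γ`-liminf inequality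
`φ₀(u(t)) ≤ ϕ(t)` this gives both `φ₀(u(t)) = ϕ(t)` and `|∂φ₀|(u(t)) ≤ liminf |∂φ_ε|(Z_ε(t))`,
and Fatou's lemma bounds the slope term. The bound `d(u(s), u(t))² ≤ (t - s) (G(t) - G(s))`,
inherited from the discrete actions, controls the metric derivative. -/

section RealFunctions

theorem disjoint_uIoc_of_monotoneOn {G : ℝ → ℝ} {S : Set ℝ} (hG : MonotoneOn G S)
    {p q p' q' : ℝ} (hp : p ∈ S) (hq : q ∈ S) (hp' : p' ∈ S) (hq' : q' ∈ S)
    (h : Disjoint (uIoc p q) (uIoc p' q')) :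
    Disjoint (uIoc (G p) (G q)) (uIoc (G p') (G q')) := by
  have hmin : ∀ {x y : ℝ}, x ∈ S → y ∈ S → min x y ∈ S := min_rec' (· ∈ S)
  have hmax : ∀ {x y : ℝ}, x ∈ S → y ∈ S → max x y ∈ S := max_rec' (· ∈ S)
  simp only [uIoc, Ioc_disjoint_Ioc] at h ⊢
  rw [← hG.map_min hp hq, ← hG.map_min hp' hq', ← hG.map_max hp hq, ← hG.map_max hp' hq',
    ← hG.map_min (hmax hp hq) (hmax hp' hq'), ← hG.map_max (hmin hp hq) (hmin hp' hq')]
  exact hG (hmin (hmax hp hq) (hmax hp' hq')) (hmax (hmin hp hq) (hmin hp' hq')) h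

theorem sum_dist_le_of_monotoneOn {G : ℝ → ℝ} {a b : ℝ} (hab : a ≤ b)
    (hG : MonotoneOn G (Icc a b)) {n : ℕ} {I : ℕ → ℝ × ℝ}
    (hI : (n, I) ∈ AbsolutelyContinuousOnInterval.disjWithin a b) :
    ∑ i ∈ Finset.range n, dist (G (I i).1) (G (I i).2) ≤ G b - G a := by
  obtain ⟨hmem, hdisj⟩ := hI
  simp only [uIcc_of_le hab] at hmem hdisj
  have hGab : G a ≤ G b := hG (left_mem_Icc.2 hab) (right_mem_Icc.2 hab) hab
  have hGdisj : (Finset.range n : Set ℕ).PairwiseDisjoint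
      fun i => uIoc (G (I i).1) (G (I i).2) := fun i hi j hj hij =>
    disjoint_uIoc_of_monotoneOn hG (hmem i hi).1 (hmem i hi).2 (hmem j hj).1 (hmem j hj).2
      (hdisj hi hj hij)
  have hGmem : (n, fun i => (G (I i).1, G (I i).2)) ∈
      AbsolutelyContinuousOnInterval.disjWithin (G a) (G b) := by
    refine ⟨fun i hi => ?_, hGdisj⟩
    rw [uIcc_of_le hGab]
    exact ⟨hG.mapsTo_Icc (hmem i hi).1, hG.mapsTo_Icc (hmem i hi).2⟩
  have hvol := measure_mono (μ := volume)
    (AbsolutelyContinuousOnInterval.biUnion_uIoc_subset_of_mem_disjWithin hGmem)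
  rw [measure_biUnion_finset hGdisj fun _ _ => measurableSet_uIoc] at hvol
  simp only [Real.volume_uIoc, abs_of_nonneg (sub_nonneg.2 hGab)] at hvol
  rw [← ENNReal.ofReal_sum_of_nonneg fun _ _ => abs_nonneg _,
    ENNReal.ofReal_le_ofReal_iff (sub_nonneg.2 hGab)] at hvol
  simpa only [dist_comm (G (I _).1), Real.dist_eq] using hvol

theorem lintegral_ofReal_deriv_le_of_monotoneOn {G : ℝ → ℝ} {a b : ℝ} (hab : a ≤ b)
    (hG : MonotoneOn G (Icc a b)) :
    ∫⁻ x in Icc a b, ENNReal.ofReal (deriv G x) ≤ ENNReal.ofReal (G b - G a) := by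
  obtain ⟨g, hg, hgm, hle⟩ := hG.exists_tendsto_deriv_liminf_lintegral_enorm_le hab
  calc ∫⁻ x in Icc a b, ENNReal.ofReal (deriv G x)
      ≤ ∫⁻ x in Icc a b, ‖deriv G x‖ₑ := lintegral_mono fun x => Real.ofReal_le_enorm _
    _ ≤ _ := lintegral_enorm_le_liminf_of_tendsto hg fun n => (hgm n).aemeasurable.enorm
    _ ≤ _ := hle

theorem lintegral_ofReal_le_of_mul_sub_le {g : ℝ → ℝ} {k : ℝ → ℝ → ℝ} {a b : ℝ} (hab : a ≤ b)
    (hg : MonotoneOn g (Icc a b)) (hk : ∀ x ∈ Ioo a b, ContinuousAt (k x) x)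
    (hle : ∀ x ∈ Ioo a b, ∀ y ∈ Ioo a b, x < y → k x y * (y - x) ≤ g y - g x) :
    ∫⁻ x in Icc a b, ENNReal.ofReal (k x x) ≤ ENNReal.ofReal (g b - g a) := by
  refine le_trans (lintegral_mono_ae ?_) (lintegral_ofReal_deriv_le_of_monotoneOn hab hg)
  rw [← restrict_Ioo_eq_restrict_Icc, ae_restrict_iff' measurableSet_Ioo]
  filter_upwards [hg.ae_differentiableWithinAt_of_mem] with x hgx hx
  have hderiv := ((hgx (Ioo_subset_Icc_self hx)).differentiableAt
    (Icc_mem_nhds hx.1 hx.2)).hasDerivAt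
  refine ENNReal.ofReal_le_ofReal (le_of_tendsto_of_tendsto
    ((hk x hx).mono_left nhdsWithin_le_nhds)
    (hderiv.tendsto_slope.mono_left (nhdsGT_le_nhdsNE x)) ?_)
  filter_upwards [Ioo_mem_nhdsGT hx.2] with y hy
  rw [slope_def_field, le_div_iff₀ (sub_pos.2 hy.1)]
  exact hle x hx y ⟨hx.1.trans hy.1, hy.2⟩ hy.1

theorem ae_deriv_le_of_sub_le_integral {f B : ℝ → ℝ} {a b : ℝ} (hab : a ≤ b)
    (hf : ∀ᵐ x, x ∈ Icc a b → DifferentiableAt ℝ f x) (hB : IntegrableOn B (Icc a b))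
    (hle : ∀ s t, a ≤ s → s ≤ t → t ≤ b → f t - f s ≤ ∫ r in s..t, B r) :
    deriv f ≤ᵐ[volume.restrict (Icc a b)] B := by
  have hBI : IntervalIntegrable B volume a b :=
    (intervalIntegrable_iff_integrableOn_Icc_of_le hab).2 hB
  rw [EventuallyLE, ← restrict_Ioo_eq_restrict_Icc, ae_restrict_iff' measurableSet_Ioo]
  filter_upwards [hf, hBI.ae_hasDerivAt_integral] with x hfx hBx hx
  have hxI : x ∈ Icc a b := Ioo_subset_Icc_self hx
  rw [uIcc_of_le hab] at hBx
  refine le_of_tendsto_of_tendsto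
    ((hfx hxI).hasDerivAt.tendsto_slope.mono_left (nhdsGT_le_nhdsNE x))
    ((hBx hxI x hxI).tendsto_slope.mono_left (nhdsGT_le_nhdsNE x)) ?_
  filter_upwards [Ioc_mem_nhdsGT hx.2] with y hy
  simp only [slope_def_field, intervalIntegral.integral_same, sub_zero]
  exact div_le_div_of_nonneg_right (hle x y hx.1.le hy.1.le hy.2) (sub_pos.2 hy.1).le

theorem exists_subseq_tendsto_of_countable {ι : Type*} [Countable ι] {f : ℕ → ι → ℝ} {C : ℝ}
    (hC : ∀ n i, |f n i| ≤ C) :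
    ∃ σ : ℕ → ℕ, StrictMono σ ∧ ∃ g : ι → ℝ, ∀ i,
      Tendsto (fun n => f (σ n) i) atTop (𝓝 (g i)) := by
  have hK : IsCompact (Set.pi univ fun _ : ι => Icc (-C) C) :=
    isCompact_univ_pi fun _ => isCompact_Icc
  obtain ⟨g, -, σ, hσ, hg⟩ := hK.tendsto_subseq (x := f) fun n i _ => abs_le.1 (hC n i)
  exact ⟨σ, hσ, g, fun i => (tendsto_pi_nhds.1 hg) i⟩

theorem tendsto_limsup_of_antitone_of_tendsto_rat {f : ℕ → ℝ → ℝ} {C : ℝ}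
    (hf : ∀ n, Antitone (f n)) (hC : ∀ n t, |f n t| ≤ C) {g : ℚ → ℝ}
    (hg : ∀ q : ℚ, Tendsto (fun n => f n q) atTop (𝓝 (g q))) {t : ℝ}
    (ht : ContinuousAt (fun s => limsup (fun n => f n s) atTop) t) :
    Tendsto (fun n => f n t) atTop (𝓝 (limsup (fun n => f n t) atTop)) := by
  have hle : ∀ t, IsBoundedUnder (· ≤ ·) atTop fun n => f n t := fun t =>
    isBoundedUnder_of ⟨C, fun n => (abs_le.1 (hC _ t)).2⟩
  have hge : ∀ t, IsBoundedUnder (· ≥ ·) atTop fun n => f n t := fun t =>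
    isBoundedUnder_of ⟨-C, fun n => (abs_le.1 (hC _ t)).1⟩
  refine tendsto_of_le_liminf_of_limsup_le (le_of_forall_lt fun c hc => ?_) le_rfl (hle t) (hge t)
  obtain ⟨δ, hδ, hball⟩ := Metric.eventually_nhds_iff.1 (ht.eventually (lt_mem_nhds hc))
  obtain ⟨q, htq, hqt⟩ := exists_rat_btwn (lt_add_of_pos_right t hδ)
  calc c < limsup (fun n => f n q) atTop :=
        hball (by rw [Real.dist_eq, abs_lt]; constructor <;> linarith)
    _ = liminf (fun n => f n q) atTop := by rw [(hg q).limsup_eq, (hg q).liminf_eq]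
    _ ≤ liminf (fun n => f n t) atTop :=
        liminf_le_liminf (Eventually.of_forall fun n => hf _ htq.le) (hge q)
          (hle t).isCoboundedUnder_ge

/-- **Helly's selection theorem** -/
theorem exists_subseq_tendsto_of_antitone {f : ℕ → ℝ → ℝ} {C : ℝ}
    (hf : ∀ n, Antitone (f n)) (hC : ∀ n t, |f n t| ≤ C) :
    ∃ σ : ℕ → ℕ, StrictMono σ ∧ ∃ F : ℝ → ℝ, ∀ t,
      Tendsto (fun n => f (σ n) t) atTop (𝓝 (F t)) := by
  obtain ⟨σ, hσ, g, hg⟩ := exists_subseq_tendsto_of_countable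
    (f := fun n (q : ℚ) => f n q) (fun n q => hC n q)
  set F : ℝ → ℝ := fun t => limsup (fun n => f (σ n) t) atTop
  have hF : Antitone F := fun s t hst =>
    limsup_le_limsup (Eventually.of_forall fun n => hf _ hst)
      (isBoundedUnder_of ⟨-C, fun n => (abs_le.1 (hC _ t)).1⟩).isCoboundedUnder_le
      (isBoundedUnder_of ⟨C, fun n => (abs_le.1 (hC _ s)).2⟩)
  have : Countable {t | ¬ContinuousAt F t} := hF.countable_not_continuousAt.to_subtype
  obtain ⟨ρ, hρ, k, hk⟩ := exists_subseq_tendsto_of_countable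
    (f := fun n (t : {t | ¬ContinuousAt F t}) => f (σ n) t) (fun n t => hC _ t)
  classical
  refine ⟨σ ∘ ρ, hσ.comp hρ, fun t => if h : ContinuousAt F t then F t else k ⟨t, h⟩, fun t => ?_⟩
  by_cases h : ContinuousAt F t
  · simpa only [h, dite_true, Function.comp_def] using
      (tendsto_limsup_of_antitone_of_tendsto_rat (fun n => hf (σ n)) (fun n => hC (σ n)) hg h).comp
        hρ.tendsto_atTop
  · simpa only [h, dite_false, Function.comp_apply] using hk ⟨t, h⟩

theorem exists_subseq_tendsto_of_antitoneOn_Icc {f : ℕ → ℝ → ℝ} {C a b : ℝ} (hab : a ≤ b)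
    (hf : ∀ n, AntitoneOn (f n) (Icc a b)) (hC : ∀ n, ∀ t ∈ Icc a b, |f n t| ≤ C) :
    ∃ σ : ℕ → ℕ, StrictMono σ ∧ ∃ F : ℝ → ℝ, ∀ t ∈ Icc a b,
      Tendsto (fun n => f (σ n) t) atTop (𝓝 (F t)) := by
  obtain ⟨σ, hσ, F, hF⟩ := exists_subseq_tendsto_of_antitone
    (f := fun n t => f n (projIcc a b hab t))
    (fun n s t hst => hf n (projIcc a b hab s).2 (projIcc a b hab t).2 (monotone_projIcc hab hst))
    (fun n t => hC n _ (projIcc a b hab t).2)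
  refine ⟨σ, hσ, F, fun t ht => ?_⟩
  simpa only [projIcc_of_mem hab ht] using hF t

end RealFunctions

section MetricSpace

variable {X : Type*} [MetricSpace X]

/-- `G` bounds the action of the curve `u` on `S`: it is monotone there and
`d(u s, u t)² ≤ (t - s) (G t - G s)`, so that formally `∫_s^t |u'|² ≤ G t - G s`. -/
structure HasActionBoundOn (u : ℝ → X) (G : ℝ → ℝ) (S : Set ℝ) : Prop where
  monotoneOn : MonotoneOn G S
  sq_dist_le : ∀ s ∈ S, ∀ t ∈ S, s ≤ t → dist (u s) (u t) ^ 2 ≤ (t - s) * (G t - G s)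

namespace HasActionBoundOn

variable {u : ℝ → X} {G : ℝ → ℝ} {S : Set ℝ} {a b : ℝ}

theorem mono {R : Set ℝ} (h : HasActionBoundOn u G S) (hRS : R ⊆ S) : HasActionBoundOn u G R :=
  ⟨h.monotoneOn.mono hRS, fun s hs t ht => h.sq_dist_le s (hRS hs) t (hRS ht)⟩

theorem sq_dist_le_dist_mul_dist (h : HasActionBoundOn u G S) {s t : ℝ} (hs : s ∈ S)
    (ht : t ∈ S) : dist (u s) (u t) ^ 2 ≤ dist s t * dist (G s) (G t) := by
  wlog hst : s ≤ t generalizing s t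
  · simpa only [dist_comm] using this ht hs (le_of_not_ge hst)
  rw [dist_comm s, dist_comm (G s), Real.dist_eq, Real.dist_eq, abs_of_nonneg (sub_nonneg.2 hst),
    abs_of_nonneg (sub_nonneg.2 (h.monotoneOn hs ht hst))]
  exact h.sq_dist_le s hs t ht hst

theorem absolutelyContinuousOnInterval (h : HasActionBoundOn u G (Icc a b)) (hab : a ≤ b) :
    AbsolutelyContinuousOnInterval u a b := by
  have hlen : Tendsto (fun E : ℕ × (ℕ → ℝ × ℝ) =>
      √((∑ i ∈ Finset.range E.1, dist (E.2 i).1 (E.2 i).2) * (G b - G a)))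
      (AbsolutelyContinuousOnInterval.totalLengthFilter ⊓
        𝓟 (AbsolutelyContinuousOnInterval.disjWithin a b)) (𝓝 0) := by
    have hlim := ((tendsto_comap (f := fun E : ℕ × (ℕ → ℝ × ℝ) =>
      ∑ i ∈ Finset.range E.1, dist (E.2 i).1 (E.2 i).2) (x := 𝓝 0)).mul_const (G b - G a)).sqrt
    rw [zero_mul, Real.sqrt_zero] at hlim
    exact hlim.mono_left inf_le_left
  refine squeeze_zero' (Eventually.of_forall fun E => Finset.sum_nonneg fun _ _ => dist_nonneg)
    ?_ hlen
  filter_upwards [mem_inf_of_right (mem_principal_self _)] with ⟨n, I⟩ hI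
  refine Real.le_sqrt_of_sq_le ?_
  have hmem := hI.1
  rw [uIcc_of_le hab] at hmem
  calc (∑ i ∈ Finset.range n, dist (u (I i).1) (u (I i).2)) ^ 2
      ≤ (∑ i ∈ Finset.range n, dist (I i).1 (I i).2) *
          ∑ i ∈ Finset.range n, dist (G (I i).1) (G (I i).2) :=
        Finset.sum_sq_le_sum_mul_sum_of_sq_le_mul _ (fun _ _ => dist_nonneg)
          (fun _ _ => dist_nonneg) fun i hi =>
          h.sq_dist_le_dist_mul_dist (hmem i hi).1 (hmem i hi).2
    _ ≤ _ := mul_le_mul_of_nonneg_left (sum_dist_le_of_monotoneOn hab h.monotoneOn hI)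
        (Finset.sum_nonneg fun _ _ => dist_nonneg)

theorem eVariationOn_le (h : HasActionBoundOn u G (Icc a b)) :
    eVariationOn u (Icc a b) ≤ ENNReal.ofReal (√((b - a) * (G b - G a))) := by
  refine iSup_le ?_
  rintro ⟨n, I, hI, hmem⟩
  have hGI : ∀ i, G (I i) ≤ G (I (i + 1)) := fun i =>
    h.monotoneOn (hmem i) (hmem (i + 1)) (hI i.le_succ)
  have hab : a ≤ b := (hmem 0).1.trans (hmem 0).2
  simp only [edist_comm (u (I (_ + 1))), edist_dist]
  rw [← ENNReal.ofReal_sum_of_nonneg fun _ _ => dist_nonneg]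
  refine ENNReal.ofReal_le_ofReal (Real.le_sqrt_of_sq_le ?_)
  calc (∑ i ∈ Finset.range n, dist (u (I i)) (u (I (i + 1)))) ^ 2
      ≤ (∑ i ∈ Finset.range n, (I (i + 1) - I i)) *
          ∑ i ∈ Finset.range n, (G (I (i + 1)) - G (I i)) :=
        Finset.sum_sq_le_sum_mul_sum_of_sq_le_mul _ (fun i _ => sub_nonneg.2 (hI i.le_succ))
          (fun i _ => sub_nonneg.2 (hGI i)) fun i _ =>
          h.sq_dist_le _ (hmem i) _ (hmem (i + 1)) (hI i.le_succ)
    _ = (I n - I 0) * (G (I n) - G (I 0)) := by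
        rw [Finset.sum_range_sub I, Finset.sum_range_sub fun i => G (I i)]
    _ ≤ (b - a) * (G b - G a) :=
        mul_le_mul (sub_le_sub (hmem n).2 (hmem 0).1)
          (sub_le_sub (h.monotoneOn (hmem n) (right_mem_Icc.2 hab) (hmem n).2)
            (h.monotoneOn (left_mem_Icc.2 hab) (hmem 0) (hmem 0).1))
          (sub_nonneg.2 (h.monotoneOn (hmem 0) (hmem n) (hI n.zero_le)))
          (sub_nonneg.2 hab)

theorem locallyBoundedVariationOn (h : HasActionBoundOn u G S) (hS : S.OrdConnected) :
    LocallyBoundedVariationOn u S := fun s t hs ht => by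
  rw [inter_eq_right.2 (hS.out hs ht)]
  exact ne_top_of_le_ne_top ENNReal.ofReal_ne_top (h.mono (hS.out hs ht)).eVariationOn_le

protected theorem variationOnFromTo (h : HasActionBoundOn u G S) (hS : S.OrdConnected)
    (ha : a ∈ S) : HasActionBoundOn (variationOnFromTo u S a) G S := by
  refine ⟨h.monotoneOn, fun s hs t ht hst => ?_⟩
  have hsub : Icc s t ⊆ S := hS.out hs ht
  rw [dist_comm, Real.dist_eq,
    variationOnFromTo.sub_right (h.locallyBoundedVariationOn hS) ha ht hs, sq_abs,
    variationOnFromTo.eq_of_le u S hst, inter_eq_right.2 hsub,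
    ← Real.le_sqrt ENNReal.toReal_nonneg
      (mul_nonneg (sub_nonneg.2 hst) (sub_nonneg.2 (h.monotoneOn hs ht hst)))]
  exact ENNReal.toReal_le_of_le_ofReal (Real.sqrt_nonneg _) (h.mono hsub).eVariationOn_le

theorem sq_deriv_le_deriv {f : ℝ → ℝ} (h : HasActionBoundOn f G (Icc a b)) {x : ℝ}
    (hx : x ∈ Ioo a b) (hf : DifferentiableAt ℝ f x) (hG : DifferentiableAt ℝ G x) :
    deriv f x ^ 2 ≤ deriv G x := by
  refine le_of_tendsto_of_tendsto
    ((hf.hasDerivAt.tendsto_slope.mono_left (nhdsGT_le_nhdsNE x)).pow 2)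
    (hG.hasDerivAt.tendsto_slope.mono_left (nhdsGT_le_nhdsNE x)) ?_
  filter_upwards [Ioc_mem_nhdsGT hx.2] with y hy
  have hpos : 0 < y - x := sub_pos.2 hy.1
  have hsq := h.sq_dist_le x (Ioo_subset_Icc_self hx) y ⟨hx.1.le.trans hy.1.le, hy.2⟩ hy.1.le
  rw [dist_comm, Real.dist_eq, sq_abs] at hsq
  rw [slope_def_field, slope_def_field, div_pow, div_le_div_iff₀ (by positivity) hpos]
  nlinarith

theorem lintegral_sq_deriv_le {f : ℝ → ℝ} (h : HasActionBoundOn f G (Icc a b)) (hab : a ≤ b) :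
    ∫⁻ r in Icc a b, ENNReal.ofReal (deriv f r ^ 2) ≤ ENNReal.ofReal (G b - G a) := by
  refine le_trans (lintegral_mono_ae ?_) (lintegral_ofReal_deriv_le_of_monotoneOn hab h.monotoneOn)
  have hf := (h.absolutelyContinuousOnInterval hab).ae_differentiableAt
  rw [uIcc_of_le hab] at hf
  rw [← restrict_Ioo_eq_restrict_Icc, ae_restrict_iff' measurableSet_Ioo]
  filter_upwards [hf, h.monotoneOn.ae_differentiableWithinAt_of_mem] with x hfx hGx hx
  have hxI : x ∈ Icc a b := Ioo_subset_Icc_self hx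
  exact ENNReal.ofReal_le_ofReal (h.sq_deriv_le_deriv hx (hfx hxI)
    ((hGx hxI).differentiableAt (Icc_mem_nhds hx.1 hx.2)))

theorem memLp_deriv {f : ℝ → ℝ} (h : HasActionBoundOn f G (Icc a b)) (hab : a ≤ b) :
    MemLp (deriv f) 2 (volume.restrict (Icc a b)) := by
  refine ⟨(measurable_deriv f).aestronglyMeasurable, ?_⟩
  rw [eLpNorm_lt_top_iff_lintegral_rpow_enorm_lt_top (by norm_num) (by norm_num)]
  refine lt_of_eq_of_lt (lintegral_congr fun r => ?_)
    ((h.lintegral_sq_deriv_le hab).trans_lt ENNReal.ofReal_lt_top)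
  rw [← sq_abs, ENNReal.ofReal_pow (abs_nonneg _), Real.enorm_eq_ofReal_abs, ENNReal.toReal_ofNat,
    ENNReal.rpow_ofNat]

end HasActionBoundOn

theorem eVariationOn_le_integral_of_dist_le_integral {u : ℝ → X} {B : ℝ → ℝ} {a b : ℝ}
    (hab : a ≤ b) (hB : IntegrableOn B (Icc a b))
    (hle : ∀ s t, a ≤ s → s ≤ t → t ≤ b → dist (u s) (u t) ≤ ∫ r in s..t, B r) :
    eVariationOn u (Icc a b) ≤ ENNReal.ofReal (∫ r in a..b, B r) := by
  have hBI : ∀ s ∈ Icc a b, ∀ t ∈ Icc a b, IntervalIntegrable B volume s t := fun s hs t ht =>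
    (hB.mono_set (OrdConnected.uIcc_subset ordConnected_Icc hs ht)).intervalIntegrable
  set F : ℝ → ℝ := fun t => ∫ r in a..t, B r
  have hF : ∀ s ∈ Icc a b, ∀ t ∈ Icc a b, ∫ r in s..t, B r = F t - F s := fun s hs t ht =>
    (intervalIntegral.integral_interval_sub_left (hBI a (left_mem_Icc.2 hab) t ht)
      (hBI a (left_mem_Icc.2 hab) s hs)).symm
  have hFmono : ∀ s ∈ Icc a b, ∀ t ∈ Icc a b, s ≤ t → F s ≤ F t := fun s hs t ht hst =>
    sub_nonneg.1 (hF s hs t ht ▸ dist_nonneg.trans (hle s t hs.1 hst ht.2))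
  refine iSup_le ?_
  rintro ⟨n, I, hI, hmem⟩
  simp only [edist_comm (u (I (_ + 1))), edist_dist]
  rw [← ENNReal.ofReal_sum_of_nonneg fun _ _ => dist_nonneg]
  apply ENNReal.ofReal_le_ofReal
  calc ∑ i ∈ Finset.range n, dist (u (I i)) (u (I (i + 1)))
      ≤ ∑ i ∈ Finset.range n, (F (I (i + 1)) - F (I i)) := Finset.sum_le_sum fun i _ =>
        (hle _ _ (hmem i).1 (hI i.le_succ) (hmem (i + 1)).2).trans_eq
          (hF _ (hmem i) _ (hmem (i + 1)))
    _ = F (I n) - F (I 0) := Finset.sum_range_sub (fun i => F (I i)) n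
    _ ≤ F b - F a := sub_le_sub (hFmono _ (hmem n) b (right_mem_Icc.2 hab) (hmem n).2)
        (hFmono a (left_mem_Icc.2 hab) _ (hmem 0) (hmem 0).1)
    _ = ∫ r in a..b, B r := (hF a (left_mem_Icc.2 hab) b (right_mem_Icc.2 hab)).symm

theorem HasActionBoundOn.exists_isMetricDerivative {u : ℝ → X} {G : ℝ → ℝ} {T : ℝ} (hT : 0 ≤ T)
    (h : HasActionBoundOn u G (Icc 0 T)) :
    ∃ m, IsMetricDerivative T u m ∧ ∀ s t, 0 ≤ s → s ≤ t → t ≤ T →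
      ∫⁻ r in Icc s t, ENNReal.ofReal (m r ^ 2) ≤ ENNReal.ofReal (G t - G s) := by
  have h0 : (0 : ℝ) ∈ Icc 0 T := left_mem_Icc.2 hT
  set V : ℝ → ℝ := variationOnFromTo u (Icc 0 T) 0
  have hV : HasActionBoundOn V G (Icc 0 T) := h.variationOnFromTo ordConnected_Icc h0
  have hVac : AbsolutelyContinuousOnInterval V 0 T := hV.absolutelyContinuousOnInterval hT
  have hbv : LocallyBoundedVariationOn u (Icc 0 T) := h.locallyBoundedVariationOn ordConnected_Icc
  have hV_sub : ∀ s t, 0 ≤ s → s ≤ t → t ≤ T → V t - V s = (eVariationOn u (Icc s t)).toReal := by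
    intro s t hs hst ht
    rw [variationOnFromTo.sub_right hbv h0 ⟨hs.trans hst, ht⟩ ⟨hs, hst.trans ht⟩,
      variationOnFromTo.eq_of_le u _ hst, inter_eq_right.2 (Icc_subset_Icc hs ht)]
  have hdist_le : ∀ s t, 0 ≤ s → s ≤ t → t ≤ T → dist (u s) (u t) ≤ ∫ r in s..t, deriv V r := by
    intro s t hs hst ht
    have hsub : Icc s t ⊆ Icc 0 T := Icc_subset_Icc hs ht
    rw [(hVac.mono (by rwa [uIcc_of_le hst, uIcc_of_le hT])).integral_deriv_eq_sub,
      hV_sub s t hs hst ht, dist_edist]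
    exact ENNReal.toReal_mono
      (ne_top_of_le_ne_top ENNReal.ofReal_ne_top (h.mono hsub).eVariationOn_le)
      (eVariationOn.edist_le u (left_mem_Icc.2 hst) (right_mem_Icc.2 hst))
  refine ⟨deriv V, ⟨⟨hV.memLp_deriv hT, hdist_le⟩, ?_⟩, fun s t hs hst ht =>
    (hV.mono (Icc_subset_Icc hs ht)).lintegral_sq_deriv_le hst⟩
  rintro B ⟨hBL, hB⟩
  have hBint : IntegrableOn B (Icc 0 T) := hBL.integrable one_le_two
  have hVdiff := hVac.ae_differentiableAt
  rw [uIcc_of_le hT] at hVdiff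
  refine ae_deriv_le_of_sub_le_integral hT hVdiff hBint fun s t hs hst ht => ?_
  rw [hV_sub s t hs hst ht]
  exact ENNReal.toReal_le_of_le_ofReal (dist_nonneg.trans (hB s t hs hst ht))
    (eVariationOn_le_integral_of_dist_le_integral hst (hBint.mono_set (Icc_subset_Icc hs ht))
      fun p q hp hpq hq => hB p q (hs.trans hp) hpq (hq.trans ht))

section Slope

theorem descSlope_le_of_eventually {φ : X → EReal} {x : X} {α c : ℝ} (hc : 0 ≤ c)
    (hx : φ x = α) (h : ∀ᶠ y in 𝓝 x, ((α - dist x y * c : ℝ) : EReal) ≤ φ y) :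
    descSlope φ x ≤ ENNReal.ofReal c := by
  rw [descSlope, if_neg (hx ▸ EReal.coe_ne_top α)]
  refine limsup_le_of_le (h := ?_)
  filter_upwards [h.filter_mono nhdsWithin_le_nhds] with y hy
  refine ENNReal.div_le_of_le_mul ?_
  rw [hx, edist_dist, ← ENNReal.ofReal_mul hc]
  induction hφ : φ y with
  | bot => exact absurd (le_bot_iff.1 (hφ ▸ hy)) (EReal.coe_ne_bot _)
  | top => simp
  | coe β =>
    rw [hφ, EReal.coe_le_coe_iff] at hy
    rw [← EReal.coe_sub, EReal.toENNReal_of_ne_top (EReal.coe_ne_top _), EReal.toReal_coe]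
    exact ENNReal.ofReal_le_ofReal (by linarith)

theorem le_descSlope_of_tendsto {ι : Type*} {l : Filter ι} [NeBot l] {φ : X → EReal} {x : X}
    {α c : ℝ} (hx : φ x = α) {y : ι → X} (hy : Tendsto y l (𝓝[≠] x))
    (h : ∀ᶠ i in l, φ (y i) ≤ ((α - dist x (y i) * c : ℝ) : EReal)) :
    ENNReal.ofReal c ≤ descSlope φ x := by
  rw [descSlope, if_neg (hx ▸ EReal.coe_ne_top α)]
  refine le_limsup_of_frequently_le (hy.frequently (Eventually.frequently ?_))
  filter_upwards [h, hy.eventually self_mem_nhdsWithin] with i hi hne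
  have hpos : 0 < dist x (y i) := dist_pos.2 (Ne.symm hne)
  rw [edist_dist, ENNReal.le_div_iff_mul_le (Or.inl (by simpa using hpos))
    (Or.inl ENNReal.ofReal_ne_top), ← ENNReal.ofReal_mul' hpos.le, hx]
  induction hφ : φ (y i) with
  | bot => simp
  | top => exact absurd (top_le_iff.1 (hφ ▸ hi)) (EReal.coe_ne_top _)
  | coe β =>
    rw [hφ, EReal.coe_le_coe_iff] at hi
    rw [← EReal.coe_sub, EReal.toENNReal_of_ne_top (EReal.coe_ne_top _), EReal.toReal_coe]
    exact ENNReal.ofReal_le_ofReal (by linarith)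

theorem tendsto_nhdsNE_of_dist_eq_mul {x : X} {γ : ℝ → X} {D : ℝ} (hD : D ≠ 0)
    (hγ : ∀ t ∈ Icc (0 : ℝ) 1, dist (γ t) x = t * D) :
    Tendsto γ (𝓝[>] 0) (𝓝[≠] x) := by
  have hev : ∀ᶠ t in 𝓝[>] (0 : ℝ), t ∈ Ioo (0 : ℝ) 1 := Ioo_mem_nhdsGT zero_lt_one
  refine tendsto_nhdsWithin_iff.2 ⟨tendsto_iff_dist_tendsto_zero.2 ?_, ?_⟩
  · have hlim : Tendsto (fun t : ℝ => t * D) (𝓝[>] 0) (𝓝 (0 * D)) :=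
      (tendsto_id.mul_const D).mono_left nhdsWithin_le_nhds
    rw [zero_mul] at hlim
    exact hlim.congr' (hev.mono fun t ht => (hγ t (Ioo_subset_Icc_self ht)).symm)
  · filter_upwards [hev] with t ht
    rw [mem_compl_singleton_iff, ← dist_ne_zero, hγ t (Ioo_subset_Icc_self ht)]
    exact mul_ne_zero ht.1.ne' hD

theorem IsGeodesicallyConvex.slopeConeProperty {ψ : X → EReal} (hbot : ∀ x, ψ x ≠ ⊥)
    (hψ : IsGeodesicallyConvex ψ) : SlopeConeProperty ψ := by
  intro x hx hslope y
  by_cases hy : ψ y = ⊤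
  · simp [hy]
  rcases eq_or_ne x y with rfl | hxy
  · simp
  obtain ⟨γ, h0, -, hγ, hconv⟩ := hψ x y hx hy
  lift ψ x to ℝ using ⟨hx, hbot x⟩ with α hα
  lift ψ y to ℝ using ⟨hy, hbot y⟩ with β
  have hD : 0 < dist x y := dist_pos.2 hxy
  have hdist : ∀ t ∈ Icc (0 : ℝ) 1, dist (γ t) x = t * dist x y := fun t ht => by
    rw [← h0, hγ t ht 0 ⟨le_rfl, zero_le_one⟩, sub_zero, abs_of_nonneg ht.1, h0]
  have hchord : ENNReal.ofReal ((α - β) / dist x y) ≤ descSlope ψ x := by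
    refine le_descSlope_of_tendsto hα.symm (tendsto_nhdsNE_of_dist_eq_mul hD.ne' hdist) ?_
    filter_upwards [Ioo_mem_nhdsGT zero_lt_one] with t ht
    have htI := Ioo_subset_Icc_self ht
    refine (hconv t htI).trans_eq ?_
    rw [dist_comm, hdist t htI, ← EReal.coe_mul, ← EReal.coe_mul, ← EReal.coe_add]
    congr 1
    field_simp
    ring
  rw [ENNReal.ofReal_le_iff_le_toReal hslope, div_le_iff₀ hD] at hchord
  rw [← EReal.coe_sub, EReal.coe_le_coe_iff]
  linarith

end Slope

section Closure

variable {φ : ℝ → X → EReal} {φ₀ : X → EReal} {e : ℕ → ℝ} {x : X} {v v' : ℕ → X}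
  {E : ℕ → ℝ} {α : ℝ} {c : ℕ → ℝ≥0∞}

theorem GammaConverges.cone_le (hΓ : GammaConverges φ φ₀) (he : ∀ n, 0 < e n)
    (he0 : Tendsto e atTop (𝓝 0)) (hcone : ∀ n, SlopeConeProperty (φ (e n)))
    (hv : Tendsto v atTop (𝓝 x)) (hv_top : ∀ n, φ (e n) (v n) ≠ ⊤)
    (hE_le : ∀ n, (E n : EReal) ≤ φ (e n) (v n)) (hE : Tendsto E atTop (𝓝 α))
    (hc : ∀ n, descSlope (φ (e n)) (v n) ≤ c n) (hfin : liminf c atTop ≠ ⊤) (y : X) :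
    ((α - dist x y * (liminf c atTop).toReal : ℝ) : EReal) ≤ φ₀ y := by
  obtain ⟨k, hck, hk⟩ := exists_seq_tendsto_liminf (u := c) (f := atTop)
  obtain ⟨z, hz, hlim⟩ := (hΓ (e ∘ k) (fun n => he _) (he0.comp hk)).2 y
  have htend : Tendsto (fun j => ((E (k j) - dist (v (k j)) (z j) * (c (k j)).toReal : ℝ) : EReal))
      atTop (𝓝 ((α - dist x y * (liminf c atTop).toReal : ℝ) : EReal)) :=
    (continuous_coe_real_ereal.tendsto _).comp
      ((hE.comp hk).sub (((hv.comp hk).dist hz).mul ((ENNReal.tendsto_toReal hfin).comp hck)))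
  refine le_trans ?_ hlim
  rw [← htend.limsup_eq]
  refine limsup_le_limsup ?_
  filter_upwards [hck.eventually (gt_mem_nhds hfin.lt_top)] with j hj
  refine le_trans ?_ (hcone (k j) (v (k j)) (hv_top _) (ne_top_of_le_ne_top hj.ne (hc _)) (z j))
  rw [EReal.coe_sub]
  exact EReal.sub_le_sub (hE_le _) (EReal.coe_le_coe
    (mul_le_mul_of_nonneg_left (ENNReal.toReal_mono hj.ne (hc _)) dist_nonneg))

theorem GammaConverges.eq_of_tendsto (hΓ : GammaConverges φ φ₀) (he : ∀ n, 0 < e n)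
    (he0 : Tendsto e atTop (𝓝 0)) (hcone : ∀ n, SlopeConeProperty (φ (e n)))
    (hv : Tendsto v atTop (𝓝 x)) (hv_top : ∀ n, φ (e n) (v n) ≠ ⊤)
    (hv' : Tendsto v' atTop (𝓝 x)) (hE_eq : ∀ n, φ (e n) (v' n) = E n)
    (hE_le : ∀ n, (E n : EReal) ≤ φ (e n) (v n)) (hE : Tendsto E atTop (𝓝 α))
    (hc : ∀ n, descSlope (φ (e n)) (v n) ≤ c n) (hfin : liminf c atTop ≠ ⊤) : φ₀ x = α := by
  refine le_antisymm (((hΓ e he he0).1 x v' hv').trans_eq ?_)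
    (by simpa using hΓ.cone_le he he0 hcone hv hv_top hE_le hE hc hfin x)
  simp only [hE_eq]
  exact ((continuous_coe_real_ereal.tendsto _).comp hE).liminf_eq

theorem GammaConverges.descSlope_le (hΓ : GammaConverges φ φ₀) (he : ∀ n, 0 < e n)
    (he0 : Tendsto e atTop (𝓝 0)) (hcone : ∀ n, SlopeConeProperty (φ (e n)))
    (hv : Tendsto v atTop (𝓝 x)) (hv_top : ∀ n, φ (e n) (v n) ≠ ⊤)
    (hv' : Tendsto v' atTop (𝓝 x)) (hE_eq : ∀ n, φ (e n) (v' n) = E n)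
    (hE_le : ∀ n, (E n : EReal) ≤ φ (e n) (v n)) (hE : Tendsto E atTop (𝓝 α))
    (hc : ∀ n, descSlope (φ (e n)) (v n) ≤ c n) :
    descSlope φ₀ x ≤ liminf c atTop := by
  by_cases hfin : liminf c atTop = ⊤
  · exact hfin ▸ le_top
  rw [← ENNReal.ofReal_toReal hfin]
  exact descSlope_le_of_eventually ENNReal.toReal_nonneg
    (hΓ.eq_of_tendsto he he0 hcone hv hv_top hv' hE_eq hE_le hE hc hfin)
    (Eventually.of_forall (hΓ.cone_le he he0 hcone hv hv_top hE_le hE hc hfin))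

end Closure

section ProxStep

namespace IsProxStep

variable {φ : X → EReal} {τ : ℝ} {p v w : X}

theorem add_le_add_of_eq_coe (h : IsProxStep φ τ p v) {β γ : ℝ} (hv : φ v = β) (hw : φ w = γ) :
    β + dist v p ^ 2 / (2 * τ) ≤ γ + dist w p ^ 2 / (2 * τ) := by
  have hle := h w
  rwa [hv, hw, ← EReal.coe_add, ← EReal.coe_add, EReal.coe_le_coe_iff] at hle

theorem ne_top (h : IsProxStep φ τ p v) (hp : φ p ≠ ⊤) : φ v ≠ ⊤ := fun hv => by
  have hle := h p
  rw [hv, EReal.top_add_coe, dist_self, zero_pow two_ne_zero, zero_div, EReal.coe_zero,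
    add_zero] at hle
  exact hp (top_le_iff.1 hle)

theorem descSlope_le (h : IsProxStep φ τ p v) (hτ : 0 < τ) {β : ℝ} (hv : φ v = β) :
    descSlope φ v ≤ ENNReal.ofReal (dist v p / τ) := by
  refine ENNReal.le_of_forall_pos_le_add fun δ hδ _ => ?_
  have hδ' : (0 : ℝ) < δ := hδ
  rw [← ENNReal.ofReal_coe_nnreal (p := δ), ← ENNReal.ofReal_add (by positivity) hδ'.le]
  refine descSlope_le_of_eventually (by positivity) hv ?_
  filter_upwards [Metric.ball_mem_nhds v (show 0 < 2 * τ * δ by positivity)] with y hy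
  rw [Metric.mem_ball, dist_comm] at hy
  induction hφ : φ y with
  | bot =>
    have hle := h y
    rw [hφ, EReal.bot_add, hv, ← EReal.coe_add] at hle
    exact absurd (le_bot_iff.1 hle) (EReal.coe_ne_bot _)
  | top => exact le_top
  | coe γ =>
    have hsq : dist y p ^ 2 ≤ (dist v y + dist v p) ^ 2 :=
      pow_le_pow_left₀ dist_nonneg (dist_comm y v ▸ dist_triangle y v p) 2
    have hquot : (dist y p ^ 2 - dist v p ^ 2) / (2 * τ) ≤ dist v y * (dist v p / τ + δ) := by
      rw [div_le_iff₀ (by positivity)]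
      calc dist y p ^ 2 - dist v p ^ 2
          ≤ dist v y * (2 * dist v p + 2 * τ * δ) := by
            nlinarith [dist_nonneg (x := v) (y := y)]
        _ = dist v y * (dist v p / τ + δ) * (2 * τ) := by field_simp
    rw [sub_div] at hquot
    rw [EReal.coe_le_coe_iff]
    linarith [h.add_le_add_of_eq_coe hv hφ]

end IsProxStep

theorem dist_sq_le_two_mul_add (x y z : X) :
    dist x z ^ 2 ≤ 2 * dist x y ^ 2 + 2 * dist y z ^ 2 := by
  nlinarith [dist_triangle x y z, sq_nonneg (dist x y - dist y z), dist_nonneg (x := x) (y := z)]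

theorem dist_sq_le_of_add_le {v p ustar : X} {Cstar τstar r α β : ℝ} (hτstar : 0 < τstar)
    (hr : 0 < r) (hrτ : r ≤ τstar / 4) (hle : β + dist v p ^ 2 / (2 * r) ≤ α)
    (hbound : Cstar ≤ β + dist v ustar ^ 2 / (2 * τstar)) :
    dist v ustar ^ 2 ≤ 2 * τstar * (α - Cstar) + 4 * dist p ustar ^ 2 := by
  have htri := dist_sq_le_two_mul_add v p ustar
  have hr_le : 2 * dist v p ^ 2 / τstar ≤ dist v p ^ 2 / (2 * r) := by
    rw [div_le_div_iff₀ hτstar (by positivity)]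
    nlinarith [sq_nonneg (dist v p)]
  have hτ_le : dist v ustar ^ 2 / (2 * τstar) ≤ (dist v p ^ 2 + dist p ustar ^ 2) / τstar := by
    rw [div_le_div_iff₀ (by positivity) hτstar]
    nlinarith
  have hvp : 2 * dist v p ^ 2 / τstar - (dist v p ^ 2 + dist p ustar ^ 2) / τstar ≤ α - Cstar := by
    linarith
  rw [← sub_div, div_le_iff₀ hτstar] at hvp
  linarith

theorem exists_forall_le_of_sublevel_subset {Y β : Type*} [TopologicalSpace Y] [LinearOrder β]
    {F : Y → β} (hF : LowerSemicontinuous F) {K : Set Y} (hK : IsCompact K) {p : Y}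
    (hsub : ∀ v, F v ≤ F p → v ∈ K) : ∃ z, ∀ w, F z ≤ F w := by
  obtain ⟨z, -, hz⟩ := LowerSemicontinuousOn.exists_isMinOn ⟨p, hsub p le_rfl⟩ hK
    (hF.lowerSemicontinuousOn K)
  refine ⟨z, fun w => ?_⟩
  by_cases hw : w ∈ K
  · exact hz hw
  · exact (hz (hsub p le_rfl)).trans (not_le.1 fun h => hw (hsub w h)).le

theorem exists_isCompact_of_bounds {φ : X → EReal} {ustar : X}
    (hcompact : ∀ C : ℝ, 0 < C → ∃ K : Set X, IsCompact K ∧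
      {v : X | dist v ustar ^ 2 ≤ C ∧ ((-C : ℝ) : EReal) ≤ φ v ∧ φ v ≤ (C : EReal)} ⊆ K)
    (M a b : ℝ) :
    ∃ K : Set X, IsCompact K ∧
      ∀ (v : X) (β : ℝ), φ v = β → dist v ustar ^ 2 ≤ M → a ≤ β → β ≤ b → v ∈ K := by
  obtain ⟨K, hK, hsub⟩ := hcompact (|M| + |a| + |b| + 1) (by positivity)
  refine ⟨K, hK, fun v β hv hM ha hb => hsub ?_⟩
  simp only [mem_ofPred_eq, hv, EReal.coe_le_coe_iff]
  refine ⟨?_, ?_, ?_⟩ <;>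
    linarith [le_abs_self M, neg_abs_le a, le_abs_self b, abs_nonneg M, abs_nonneg a, abs_nonneg b]

theorem exists_isProxStep {φ : X → EReal} {ustar : X} (hlsc : LowerSemicontinuous φ)
    (hbot : ∀ x, φ x ≠ ⊥) {Cstar τstar : ℝ} (hτstar : 0 < τstar)
    (hbound : ∀ v : X, (Cstar : EReal) ≤ φ v + ((dist v ustar ^ 2 / (2 * τstar) : ℝ) : EReal))
    (hcompact : ∀ C : ℝ, 0 < C → ∃ K : Set X, IsCompact K ∧
      {v : X | dist v ustar ^ 2 ≤ C ∧ ((-C : ℝ) : EReal) ≤ φ v ∧ φ v ≤ (C : EReal)} ⊆ K)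
    {p : X} (hp : φ p ≠ ⊤) {r : ℝ} (hr : 0 < r) (hrτ : r ≤ τstar / 4) :
    ∃ z, IsProxStep φ r p z := by
  obtain ⟨α, hα⟩ : ∃ α : ℝ, φ p = α := ⟨_, (EReal.coe_toReal hp (hbot p)).symm⟩
  set M : ℝ := 2 * τstar * (α - Cstar) + 4 * dist p ustar ^ 2
  obtain ⟨K, hK, hKmem⟩ := exists_isCompact_of_bounds hcompact M (Cstar - M / (2 * τstar)) α
  set F : X → EReal := fun v => φ v + ((dist v p ^ 2 / (2 * r) : ℝ) : EReal)
  have hF : LowerSemicontinuous F := by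
    refine LowerSemicontinuous.add' hlsc (Continuous.lowerSemicontinuous ?_) fun x =>
      EReal.continuousAt_add (Or.inr (EReal.coe_ne_bot _)) (Or.inr (EReal.coe_ne_top _))
    exact continuous_coe_real_ereal.comp (by fun_prop)
  refine exists_forall_le_of_sublevel_subset hF hK (p := p) fun v hv => ?_
  have hFp : F p = α := by simp [F, hα]
  have hFv : F v ≤ α := hv.trans_eq hFp
  have hv_top : φ v ≠ ⊤ := fun h => by
    simp only [F, h, EReal.top_add_coe] at hFv
    exact EReal.coe_ne_top α (top_le_iff.1 hFv)
  obtain ⟨β, hβ⟩ : ∃ β : ℝ, φ v = β := ⟨_, (EReal.coe_toReal hv_top (hbot v)).symm⟩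
  have hb := hbound v
  rw [hβ, ← EReal.coe_add, EReal.coe_le_coe_iff] at hb
  simp only [F, hβ, ← EReal.coe_add, EReal.coe_le_coe_iff] at hFv
  have hM : dist v ustar ^ 2 ≤ M := dist_sq_le_of_add_le hτstar hr hrτ hFv hb
  refine hKmem v β hβ hM ?_ ((le_add_of_nonneg_right (by positivity)).trans hFv)
  have := div_le_div_of_nonneg_right hM (by positivity : 0 ≤ 2 * τstar)
  linarith

end ProxStep

section DeGiorgi

variable {φ : X → EReal} {p : X} {τ : ℝ} {z : ℝ → X} {b : ℝ → ℝ}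

theorem monotoneOn_dist_of_isProxStep (hz : ∀ r ∈ Ioc 0 τ, IsProxStep φ r p (z r))
    (hb : ∀ r ∈ Ioc 0 τ, φ (z r) = b r) : MonotoneOn (fun r => dist (z r) p) (Ioc 0 τ) := by
  intro r hr s hs hrs
  rcases hrs.eq_or_lt with rfl | hlt
  · rfl
  have hrs' := (hz r hr).add_le_add_of_eq_coe (hb r hr) (hb s hs)
  have hsr := (hz s hs).add_le_add_of_eq_coe (hb s hs) (hb r hr)
  have hpos : 0 < 1 / (2 * r) - 1 / (2 * s) :=
    sub_pos.2 (one_div_lt_one_div_of_lt (by linarith [hr.1]) (by linarith))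
  have hsq : dist (z r) p ^ 2 * (1 / (2 * r) - 1 / (2 * s))
      ≤ dist (z s) p ^ 2 * (1 / (2 * r) - 1 / (2 * s)) := by
    simp only [mul_sub, mul_one_div]
    linarith
  exact le_of_sq_le_sq (le_of_mul_le_mul_right hsq hpos) dist_nonneg

theorem antitoneOn_of_isProxStep (hz : ∀ r ∈ Ioc 0 τ, IsProxStep φ r p (z r))
    (hb : ∀ r ∈ Ioc 0 τ, φ (z r) = b r) : AntitoneOn b (Ioc 0 τ) := by
  intro r hr s hs hrs
  have hle := (hz s hs).add_le_add_of_eq_coe (hb s hs) (hb r hr)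
  have hdist : dist (z r) p ^ 2 / (2 * s) ≤ dist (z s) p ^ 2 / (2 * s) :=
    div_le_div_of_nonneg_right (pow_le_pow_left₀ dist_nonneg
      (monotoneOn_dist_of_isProxStep hz hb hr hs hrs) 2) (by linarith [hs.1])
  linarith

theorem sq_dist_div_mul_sub_le_of_isProxStep (hz : ∀ r ∈ Ioc 0 τ, IsProxStep φ r p (z r))
    (hb : ∀ r ∈ Ioc 0 τ, φ (z r) = b r) {r s : ℝ} (hr : r ∈ Ioc 0 τ) (hs : s ∈ Ioc 0 τ) :
    dist (z r) p ^ 2 / (r * s) * (s - r)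
      ≤ (2 * b r + dist (z r) p ^ 2 / r) - (2 * b s + dist (z s) p ^ 2 / s) := by
  have hr0 := hr.1
  have hs0 := hs.1
  have hle := (hz s hs).add_le_add_of_eq_coe (hb s hs) (hb r hr)
  have hsplit : dist (z r) p ^ 2 / (r * s) * (s - r)
      = dist (z r) p ^ 2 / r - 2 * (dist (z r) p ^ 2 / (2 * s)) := by field_simp
  have hhalf : dist (z s) p ^ 2 / s = 2 * (dist (z s) p ^ 2 / (2 * s)) := by field_simp
  linarith

/-- The integrated form of De Giorgi's formula `d/dr φ_r(p) = -d(z r, p)² / (2 r²)` for the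
Moreau–Yosida approximation `φ_r(p) = min (φ + d(·, p)² / (2 r))`. -/
theorem lintegral_sq_dist_div_le_of_isProxStep (hτ : 0 < τ)
    (hz : ∀ r ∈ Ioc 0 τ, IsProxStep φ r p (z r)) (hb : ∀ r ∈ Ioc 0 τ, φ (z r) = b r) {α : ℝ}
    (hp : φ p = α) :
    ∫⁻ r in Ioc 0 τ, ENNReal.ofReal (dist (z r) p / r) ^ 2
      ≤ ENNReal.ofReal (2 * α - (2 * b τ + dist (z τ) p ^ 2 / τ)) := by
  -- The value `-2α` at `0` bounds `g` from below, so that `g` is monotone up to the endpoint.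
  set g : ℝ → ℝ := Function.update (fun r => -(2 * b r + dist (z r) p ^ 2 / r)) 0 (-(2 * α))
  have hg0 : g 0 = -(2 * α) := Function.update_self ..
  have hg : ∀ r ∈ Ioc 0 τ, g r = -(2 * b r + dist (z r) p ^ 2 / r) := fun r hr =>
    Function.update_of_ne hr.1.ne' ..
  have hinc : ∀ r ∈ Ioc 0 τ, ∀ s ∈ Ioc 0 τ,
      dist (z r) p ^ 2 / (r * s) * (s - r) ≤ g s - g r := fun r hr s hs => by
    rw [hg r hr, hg s hs, neg_sub_neg]
    exact sq_dist_div_mul_sub_le_of_isProxStep hz hb hr hs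
  have hmono : MonotoneOn g (Icc 0 τ) := by
    intro r hr s hs hrs
    rcases hrs.eq_or_lt with rfl | hlt
    · rfl
    have hs' : s ∈ Ioc 0 τ := ⟨hr.1.trans_lt hlt, hs.2⟩
    rcases hr.1.eq_or_lt with rfl | hr0
    · have hle : b s + dist (z s) p ^ 2 / (2 * s) ≤ α := by
        simpa using (hz s hs').add_le_add_of_eq_coe (hb s hs') hp
      rw [mul_comm, ← div_div, ← le_sub_iff_add_le', div_le_iff₀ two_pos] at hle
      rw [hg0, hg s hs', neg_le_neg_iff]
      linarith
    · exact sub_nonneg.1 (le_trans (mul_nonneg (div_nonneg (sq_nonneg _)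
        (mul_nonneg hr0.le hs'.1.le)) (sub_nonneg.2 hrs)) (hinc r ⟨hr0, hr.2⟩ s hs'))
  have hint := lintegral_ofReal_le_of_mul_sub_le hτ.le hmono
    (k := fun r s => dist (z r) p ^ 2 / (r * s))
    (fun r hr => continuousAt_const.div (by fun_prop) (by have := hr.1; positivity))
    (fun r hr s hs _ => hinc r (Ioo_subset_Ioc_self hr) s (Ioo_subset_Ioc_self hs))
  rw [hg0, hg τ (right_mem_Ioc.2 hτ), neg_sub_neg, ← restrict_Ioc_eq_restrict_Icc] at hint
  refine le_trans (setLIntegral_mono' measurableSet_Ioc fun r hr => le_of_eq ?_) hint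
  rw [← ENNReal.ofReal_pow (div_nonneg dist_nonneg hr.1.le), div_pow, sq r]

theorem exists_measurable_eqOn_dist_of_isProxStep
    (hz : ∀ r ∈ Ioc 0 τ, IsProxStep φ r p (z r)) (hb : ∀ r ∈ Ioc 0 τ, φ (z r) = b r) :
    ∃ D : ℝ → ℝ, Measurable D ∧ EqOn (fun r => dist (z r) p) D (Ioc 0 τ) := by
  rcases le_or_gt τ 0 with hτ | hτ
  · exact ⟨0, measurable_zero, by simp [Ioc_eq_empty hτ.not_gt]⟩
  have hmono := monotoneOn_dist_of_isProxStep hz hb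
  obtain ⟨D, hD, hDeq⟩ := hmono.exists_monotone_extension
    ⟨0, forall_mem_image.2 fun _ _ => dist_nonneg⟩
    ⟨dist (z τ) p, forall_mem_image.2 fun r hr => hmono hr (right_mem_Ioc.2 hτ) hr.2⟩
  exact ⟨D, hD.measurable, hDeq⟩

theorem IsProxStep.exists_variationalInterpolation {q : X} (hpq : IsProxStep φ τ p q)
    (hτ : 0 < τ) (hbot : ∀ x, φ x ≠ ⊥) (hex : ∀ r ∈ Ioc 0 τ, ∃ v, IsProxStep φ r p v) {α β : ℝ}
    (hp : φ p = α) (hq : φ q = β) :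
    ∃ (z : ℝ → X) (c : ℝ → ℝ≥0∞), Measurable c ∧
      (∀ r ∈ Ioc 0 τ, φ (z r) ≠ ⊤ ∧ φ q ≤ φ (z r) ∧ dist (z r) p ≤ dist q p ∧
        descSlope φ (z r) ≤ c r) ∧
      ∫⁻ r in Ioc 0 τ, c r ^ 2 ≤ ENNReal.ofReal (2 * α - (2 * β + dist q p ^ 2 / τ)) := by
  have hτI : τ ∈ Ioc 0 τ := right_mem_Ioc.2 hτ
  obtain ⟨z, hzτ, hz⟩ : ∃ z : ℝ → X, z τ = q ∧ ∀ r ∈ Ioc 0 τ, IsProxStep φ r p (z r) := by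
    have : Nonempty X := ⟨p⟩
    choose! z hz using hex
    refine ⟨Function.update z τ q, Function.update_self .., fun r hr => ?_⟩
    rcases eq_or_ne r τ with rfl | hne
    · rwa [Function.update_self]
    · rw [Function.update_of_ne hne]
      exact hz r hr
  have hz_top : ∀ r ∈ Ioc 0 τ, φ (z r) ≠ ⊤ := fun r hr =>
    (hz r hr).ne_top (hp ▸ EReal.coe_ne_top α)
  have hb : ∀ r ∈ Ioc 0 τ, φ (z r) = (φ (z r)).toReal := fun r hr =>
    (EReal.coe_toReal (hz_top r hr) (hbot _)).symm
  obtain ⟨D, hDm, hD⟩ := exists_measurable_eqOn_dist_of_isProxStep hz hb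
  have henergy := lintegral_sq_dist_div_le_of_isProxStep hτ hz hb hp
  rw [hzτ, hq, EReal.toReal_coe] at henergy
  refine ⟨z, fun r => ENNReal.ofReal (D r / r), (hDm.div measurable_id).ennreal_ofReal,
    fun r hr => ⟨hz_top r hr, ?_, ?_, ?_⟩, ?_⟩
  · rw [← hzτ, hb r hr, hb τ hτI]
    exact EReal.coe_le_coe_iff.2 (antitoneOn_of_isProxStep hz hb hr hτI hr.2)
  · exact hzτ ▸ monotoneOn_dist_of_isProxStep hz hb hr hτI hr.2
  · simpa only [← hD hr] using (hz r hr).descSlope_le hr.1 (hb r hr)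
  · exact (setLIntegral_congr_fun measurableSet_Ioc
      fun r hr => by simp only [← hD hr]).trans_le henergy

end DeGiorgi

section DiscreteSolution

variable {φ : X → EReal} {τ : ℝ} {p : X} {w : ℕ → X} {f : ℕ → ℝ}

theorem IsDiscreteSolution.exists_energy (h : IsDiscreteSolution φ τ p w) (hbot : ∀ x, φ x ≠ ⊥)
    (hp : φ p ≠ ⊤) : ∃ f : ℕ → ℝ, ∀ i, φ (w i) = f i := by
  have htop : ∀ i, φ (w i) ≠ ⊤ := fun i => by
    induction i with
    | zero => rwa [h.1]
    | succ i ih => exact (h.2 i).ne_top ih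
  exact ⟨fun i => (φ (w i)).toReal, fun i => (EReal.coe_toReal (htop i) (hbot _)).symm⟩

theorem IsDiscreteSolution.energy_succ_le (h : IsDiscreteSolution φ τ p w)
    (hf : ∀ i, φ (w i) = f i) (i : ℕ) :
    f (i + 1) + dist (w (i + 1)) (w i) ^ 2 / (2 * τ) ≤ f i := by
  simpa using (h.2 i).add_le_add_of_eq_coe (hf (i + 1)) (hf i)

/-- The action of a discrete solution up to the time `i τ`, that is, the discrete counterpart
of `∫₀^{i τ} |u'|²`. -/
noncomputable def discreteAction (τ : ℝ) (w : ℕ → X) (i : ℕ) : ℝ :=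
  ∑ j ∈ Finset.range i, dist (w (j + 1)) (w j) ^ 2 / τ

theorem discreteAction_succ (τ : ℝ) (w : ℕ → X) (i : ℕ) :
    discreteAction τ w (i + 1) = discreteAction τ w i + dist (w (i + 1)) (w i) ^ 2 / τ :=
  Finset.sum_range_succ _ i

theorem monotone_discreteAction (hτ : 0 ≤ τ) (w : ℕ → X) : Monotone (discreteAction τ w) :=
  monotone_nat_of_le_succ fun i => by
    rw [discreteAction_succ]
    exact le_add_of_nonneg_right (by positivity)

theorem sq_dist_le_discreteAction (hτ : 0 < τ) (w : ℕ → X) {i j : ℕ} (hij : i ≤ j) :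
    dist (w i) (w j) ^ 2 ≤ (j * τ - i * τ) * (discreteAction τ w j - discreteAction τ w i) := by
  calc dist (w i) (w j) ^ 2
      ≤ (∑ k ∈ Finset.Ico i j, dist (w k) (w (k + 1))) ^ 2 :=
        pow_le_pow_left₀ dist_nonneg (dist_le_Ico_sum_dist w hij) 2
    _ ≤ (Finset.Ico i j).card * ∑ k ∈ Finset.Ico i j, dist (w k) (w (k + 1)) ^ 2 :=
        sq_sum_le_card_mul_sum_sq
    _ = (j * τ - i * τ) * (discreteAction τ w j - discreteAction τ w i) := by
        rw [discreteAction, discreteAction, ← Finset.sum_Ico_eq_sub _ hij, ← Finset.sum_div,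
          Nat.card_Ico, Nat.cast_sub hij]
        simp only [dist_comm (w (_ + 1))]
        field_simp

theorem IsDiscreteSolution.antitone_energy_add_discreteAction (hw : IsDiscreteSolution φ τ p w)
    (hf : ∀ i, φ (w i) = f i) : Antitone fun i => 2 * f i + discreteAction τ w i :=
  antitone_nat_of_succ_le fun i => by
    have hstep := hw.energy_succ_le hf i
    rw [mul_comm, ← div_div, ← le_sub_iff_add_le', div_le_iff₀ two_pos] at hstep
    rw [discreteAction_succ]
    linarith

theorem IsDiscreteSolution.antitone_energy (hw : IsDiscreteSolution φ τ p w) (hτ : 0 ≤ τ)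
    (hf : ∀ i, φ (w i) = f i) :
    Antitone f :=
  antitone_nat_of_succ_le fun i =>
    (le_add_of_nonneg_right (by positivity)).trans (hw.energy_succ_le hf i)

theorem penalizedEnergy_le_one_add_mul {f₀ f₁ d D₀ D₁ τstar Cstar : ℝ} (hτ : 0 < τ)
    (hτstar : τ ≤ τstar / 4) (hD₁ : 0 ≤ D₁) (htri : D₁ ≤ d + D₀)
    (hstep : f₁ + d ^ 2 / (2 * τ) ≤ f₀) (hbound : Cstar ≤ f₀ + D₀ ^ 2 / (2 * τstar)) :
    f₁ + D₁ ^ 2 / τstar - Cstar ≤ (1 + 8 * τ / τstar) * (f₀ + D₀ ^ 2 / τstar - Cstar) := by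
  have hτstar0 : 0 < τstar := by linarith
  have hD₁_le : D₁ ^ 2 / τstar ≤ (d + D₀) ^ 2 / τstar :=
    div_le_div_of_nonneg_right (pow_le_pow_left₀ hD₁ htri 2) hτstar0.le
  have hcross : 2 * d * D₀ / τstar
      ≤ d ^ 2 / (4 * τ) + 8 * τ / τstar * (D₀ ^ 2 / (2 * τstar)) := by
    have hdiff : d ^ 2 / (4 * τ) + 8 * τ / τstar * (D₀ ^ 2 / (2 * τstar)) - 2 * d * D₀ / τstar
        = (τstar * d - 4 * τ * D₀) ^ 2 / (4 * τ * τstar ^ 2) := by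
      field_simp
      ring
    exact sub_nonneg.1 (hdiff ▸ by positivity)
  have hd_le : d ^ 2 / τstar ≤ d ^ 2 / (4 * τ) :=
    div_le_div_of_nonneg_left (sq_nonneg d) (by positivity) (by linarith)
  have hexpand : (d + D₀) ^ 2 / τstar = d ^ 2 / τstar + 2 * d * D₀ / τstar + D₀ ^ 2 / τstar := by
    ring
  have hhalf : d ^ 2 / (2 * τ) = d ^ 2 / (4 * τ) + d ^ 2 / (4 * τ) := by
    field
  have hpos : 8 * τ / τstar * (D₀ ^ 2 / (2 * τstar))
      ≤ 8 * τ / τstar * (f₀ + D₀ ^ 2 / τstar - Cstar) := by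
    refine mul_le_mul_of_nonneg_left ?_ (by positivity)
    have : D₀ ^ 2 / τstar = 2 * (D₀ ^ 2 / (2 * τstar)) := by field_simp
    linarith
  linarith

theorem IsDiscreteSolution.sub_exp_mul_le_energy {ustar : X} {τstar Cstar : ℝ}
    (hw : IsDiscreteSolution φ τ p w) (hτ : 0 < τ) (hτstar : τ ≤ τstar / 4)
    (hf : ∀ i, φ (w i) = f i)
    (hbound : ∀ i, Cstar ≤ f i + dist (w i) ustar ^ 2 / (2 * τstar)) (n : ℕ) :
    Cstar - (f 0 + dist (w 0) ustar ^ 2 / τstar - Cstar) * Real.exp (8 * (n * τ) / τstar)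
      ≤ f n := by
  have hτstar0 : 0 < τstar := by linarith
  set E : ℕ → ℝ := fun i => f i + dist (w i) ustar ^ 2 / τstar - Cstar
  have hE : ∀ i, dist (w i) ustar ^ 2 / (2 * τstar) ≤ E i := fun i => by
    have : dist (w i) ustar ^ 2 / τstar = 2 * (dist (w i) ustar ^ 2 / (2 * τstar)) := by field_simp
    linarith [hbound i]
  have hgronwall := discrete_gronwall (u := E) (b := 0) (c := fun _ => 8 * τ / τstar) (n₀ := 0)
    (le_trans (by positivity) (hE 0))
    (fun i _ => by
      simpa only [Pi.zero_apply, add_zero] using penalizedEnergy_le_one_add_mul hτ hτstar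
        dist_nonneg (dist_triangle _ _ _) (hw.energy_succ_le hf i) (hbound i))
    (fun _ _ => by positivity) (fun _ _ => le_rfl) n.zero_le
  simp only [Pi.zero_apply, Finset.sum_const_zero, add_zero, Finset.sum_const, Nat.card_Ico,
    Nat.sub_zero, nsmul_eq_mul] at hgronwall
  rw [show 8 * (n * τ) / τstar = n * (8 * τ / τstar) by ring]
  linarith [hbound n, hE n]

end DiscreteSolution

section Stepwise

variable {β : Type*} {τ r : ℝ}

/-- The function of time that runs through `C i` on the step `(i τ, (i + 1) τ]`, each `C i`
being a function on `(0, τ]`. -/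
noncomputable def stepwise (τ : ℝ) (C : ℕ → ℝ → β) (t : ℝ) : β :=
  C (⌈t / τ⌉₊ - 1) (t - (⌈t / τ⌉₊ - 1 : ℕ) * τ)

theorem ceil_nat_mul_add_div (i : ℕ) (hr : r ∈ Ioc 0 τ) : ⌈(i * τ + r) / τ⌉₊ = i + 1 := by
  have hτ : 0 < τ := hr.1.trans_le hr.2
  rw [Nat.ceil_eq_iff i.add_one_ne_zero, Nat.add_sub_cancel, lt_div_iff₀ hτ, div_le_iff₀ hτ]
  push_cast
  constructor <;> linarith [hr.1, hr.2]

theorem exists_eq_nat_mul_add (hτ : 0 < τ) {t : ℝ} (ht : 0 < t) :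
    ∃ i : ℕ, ∃ r ∈ Ioc 0 τ, t = i * τ + r := by
  obtain ⟨i, hi⟩ : ∃ i, ⌈t / τ⌉₊ = i + 1 :=
    Nat.exists_eq_succ_of_ne_zero (Nat.ceil_pos.2 (div_pos ht hτ)).ne'
  refine ⟨i, t - i * τ, ?_, by ring⟩
  rw [Nat.ceil_eq_iff i.add_one_ne_zero, Nat.add_sub_cancel, lt_div_iff₀ hτ, div_le_iff₀ hτ] at hi
  push_cast at hi
  constructor <;> linarith [hi.1, hi.2]

theorem stepwise_nat_mul_add (C : ℕ → ℝ → β) (i : ℕ) (hr : r ∈ Ioc 0 τ) :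
    stepwise τ C (i * τ + r) = C i r := by
  rw [stepwise, ceil_nat_mul_add_div i hr, Nat.add_sub_cancel, add_sub_cancel_left]

theorem measurable_stepwise [MeasurableSpace β] {C : ℕ → ℝ → β} (hC : ∀ i, Measurable (C i)) :
    Measurable (stepwise τ C) := by
  have hindex : Measurable fun t : ℝ => ⌈t / τ⌉₊ - 1 :=
    (measurable_from_top (f := fun n : ℕ => n - 1)).comp
      (Nat.measurable_ceil.comp (measurable_id.div_const τ))
  have hoffset : Measurable fun t : ℝ => t - (⌈t / τ⌉₊ - 1 : ℕ) * τ :=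
    measurable_id.sub
      (((measurable_from_top (f := fun n : ℕ => (n : ℝ))).comp hindex).mul_const τ)
  exact (measurable_from_prod_countable_left (f := fun x : ℝ × ℕ => C x.2 x.1) hC).comp
    (hoffset.prodMk hindex)

theorem setLIntegral_stepwise (C : ℕ → ℝ → ℝ≥0∞) (i : ℕ) :
    ∫⁻ t in Ioc (i * τ) ((i + 1 : ℕ) * τ), stepwise τ C t = ∫⁻ r in Ioc 0 τ, C i r := by
  have hshift := (measurePreserving_add_left volume (i * τ)).setLIntegral_comp_preimage_emb
    (measurableEmbedding_addLeft _) (stepwise τ C) (Ioc (i * τ) ((i + 1 : ℕ) * τ))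
  rw [preimage_const_add_Ioc, sub_self, Nat.cast_succ, add_one_mul, add_sub_cancel_left] at hshift
  rw [Nat.cast_succ, add_one_mul, ← hshift]
  exact setLIntegral_congr_fun measurableSet_Ioc fun r hr => stepwise_nat_mul_add C i hr

theorem setLIntegral_Ioc_nat_mul_le_of_succ {c : ℝ → ℝ≥0∞} {g : ℕ → ℝ} (hτ : 0 ≤ τ)
    (hg : Antitone g)
    (hc : ∀ i : ℕ, ∫⁻ t in Ioc (i * τ) ((i + 1 : ℕ) * τ), c t ≤ ENNReal.ofReal (g i - g (i + 1)))
    {j k : ℕ} (hjk : j ≤ k) :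
    ∫⁻ t in Ioc (j * τ) (k * τ), c t ≤ ENNReal.ofReal (g j - g k) := by
  induction k, hjk using Nat.le_induction with
  | base => simp
  | succ k hjk ih =>
    have hmono : Monotone fun i : ℕ => (i : ℝ) * τ := fun i i' hi =>
      mul_le_mul_of_nonneg_right (Nat.cast_le.2 hi) hτ
    rw [← Ioc_union_Ioc_eq_Ioc (hmono hjk) (hmono k.le_succ)]
    refine (lintegral_union_le _ _ _).trans ((add_le_add ih (hc k)).trans_eq ?_)
    rw [← ENNReal.ofReal_add (sub_nonneg.2 (hg hjk)) (sub_nonneg.2 (hg k.le_succ)),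
      sub_add_sub_cancel]

end Stepwise

section VariationalInterpolation

/-- `Z` is a variational interpolation (in the sense of De Giorgi) of the discrete solution `w`
with energies `f`, and `c` a measurable bound for the slope along it: the energy along `Z` stays
above, and `Z` stays close to, the piecewise constant interpolation, while `∫ c²` is controlled
by the decrease of twice the energy not spent in the action. -/
structure IsVariationalInterpolation (φ : X → EReal) (τ : ℝ) (w : ℕ → X) (f : ℕ → ℝ) (Z : ℝ → X)
    (c : ℝ → ℝ≥0∞) : Prop where
  measurable : Measurable c
  ne_top : ∀ t, 0 < t → φ (Z t) ≠ ⊤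
  energy_le : ∀ t, 0 < t → (f ⌈t / τ⌉₊ : EReal) ≤ φ (Z t)
  descSlope_le : ∀ t, 0 < t → descSlope φ (Z t) ≤ c t
  sq_dist_le : ∀ t, 0 < t →
    dist (Z t) (piecewiseConst τ w t) ^ 2 ≤ 4 * τ * discreteAction τ w ⌈t / τ⌉₊
  lintegral_le : ∀ j k : ℕ, j ≤ k → ∫⁻ t in Ioc (j * τ) (k * τ), c t ^ 2 ≤
    ENNReal.ofReal ((2 * f j + discreteAction τ w j) - (2 * f k + discreteAction τ w k))

theorem IsDiscreteSolution.exists_isVariationalInterpolation {φ : X → EReal} {τ : ℝ} {p : X}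
    {w : ℕ → X} {f : ℕ → ℝ} (hw : IsDiscreteSolution φ τ p w) (hτ : 0 < τ)
    (hbot : ∀ x, φ x ≠ ⊥) (hf : ∀ i, φ (w i) = f i)
    (hex : ∀ i, ∀ r ∈ Ioc 0 τ, ∃ v, IsProxStep φ r (w i) v) :
    ∃ Z c, IsVariationalInterpolation φ τ w f Z c := by
  choose z c hc hz hint using fun i =>
    (hw.2 i).exists_variationalInterpolation hτ hbot (hex i) (hf i) (hf (i + 1))
  have hstep : ∀ t, 0 < t → ∃ i : ℕ, ∃ r ∈ Ioc 0 τ, ⌈t / τ⌉₊ = i + 1 ∧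
      stepwise τ z t = z i r ∧ stepwise τ c t = c i r := fun t ht => by
    obtain ⟨i, r, hr, rfl⟩ := exists_eq_nat_mul_add hτ ht
    exact ⟨i, r, hr, ceil_nat_mul_add_div i hr, stepwise_nat_mul_add z i hr,
      stepwise_nat_mul_add c i hr⟩
  refine ⟨stepwise τ z, stepwise τ c, measurable_stepwise hc, fun t ht => ?_, fun t ht => ?_,
    fun t ht => ?_, fun t ht => ?_, fun j k hjk => ?_⟩
  · obtain ⟨i, r, hr, -, hZ, -⟩ := hstep t ht
    exact hZ ▸ (hz i r hr).1
  · obtain ⟨i, r, hr, hi, hZ, -⟩ := hstep t ht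
    rw [hi, hZ, ← hf]
    exact (hz i r hr).2.1
  · obtain ⟨i, r, hr, -, hZ, hC⟩ := hstep t ht
    rw [hZ, hC]
    exact (hz i r hr).2.2.2
  · obtain ⟨i, r, hr, hi, hZ, -⟩ := hstep t ht
    have hdist : dist (z i r) (w (i + 1)) ≤ 2 * dist (w (i + 1)) (w i) := by
      linarith [dist_triangle_right (z i r) (w (i + 1)) (w i), (hz i r hr).2.2.1]
    have haction : dist (w (i + 1)) (w i) ^ 2 ≤ discreteAction τ w (i + 1) * τ := by
      rw [← div_le_iff₀ hτ, discreteAction_succ]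
      exact le_add_of_nonneg_left (Finset.sum_nonneg fun _ _ => by positivity)
    rw [piecewiseConst, hi, hZ]
    linarith [pow_le_pow_left₀ dist_nonneg hdist 2]
  · refine setLIntegral_Ioc_nat_mul_le_of_succ (g := fun i => 2 * f i + discreteAction τ w i)
      hτ.le (hw.antitone_energy_add_discreteAction hf) (fun i => ?_) hjk
    refine (setLIntegral_stepwise (fun i r => c i r ^ 2) i).trans_le ((hint i).trans_eq ?_)
    rw [discreteAction_succ]
    congr 1
    ring

end VariationalInterpolation

theorem isCurveOfMaximalSlope_of_hasActionBoundOn {φ : X → EReal} {T : ℝ} {u : ℝ → X}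
    {ϕ G : ℝ → ℝ} {c : ℝ → ℝ≥0∞} (hT : 0 ≤ T) (hG : HasActionBoundOn u G (Icc 0 T))
    (hΨ : AntitoneOn (fun t => 2 * ϕ t + G t) (Icc 0 T)) (hc : Measurable c)
    (hslope : ∀ t ∈ Ioc 0 T, descSlope φ (u t) ≤ c t)
    (hϕ : ∀ t ∈ Ioc 0 T, c t ≠ ⊤ → φ (u t) = ϕ t)
    (henergy : ∀ s t, 0 ≤ s → s ≤ t → t ≤ T → ∫⁻ r in Icc s t, c r ^ 2 ≤
      ENNReal.ofReal ((2 * ϕ s + G s) - (2 * ϕ t + G t))) :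
    IsCurveOfMaximalSlope φ T u := by
  obtain ⟨m, hm, hmG⟩ := hG.exists_isMetricDerivative hT
  refine ⟨⟨m, hm.1⟩, m, hm, ϕ, fun s hs t ht hst => ?_, fun s t hs hst ht => ?_, ?_⟩
  · linarith [hΨ hs ht hst, hG.monotoneOn hs ht hst]
  · have hsI : s ∈ Icc 0 T := ⟨hs, hst.trans ht⟩
    have htI : t ∈ Icc 0 T := ⟨hs.trans hst, ht⟩
    have hslope_sq : ∫⁻ r in Icc s t, descSlope φ (u r) ^ 2 ≤ ∫⁻ r in Icc s t, c r ^ 2 := by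
      rw [← restrict_Ioc_eq_restrict_Icc]
      exact setLIntegral_mono' measurableSet_Ioc fun r hr =>
        pow_le_pow_left' (hslope r ⟨hs.trans_lt hr.1, hr.2.trans ht⟩) 2
    rw [← mul_add]
    refine (mul_le_mul_right (add_le_add (hmG s t hs hst ht)
      (hslope_sq.trans (henergy s t hs hst ht))) _).trans_eq ?_
    rw [← ENNReal.ofReal_add (sub_nonneg.2 (hG.monotoneOn hsI htI hst))
        (sub_nonneg.2 (hΨ hsI htI hst)),
      show G t - G s + ((2 * ϕ s + G s) - (2 * ϕ t + G t)) = 2 * (ϕ s - ϕ t) by ring,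
      ENNReal.ofReal_mul two_pos.le, ENNReal.ofReal_ofNat, ← mul_assoc, one_div,
      ENNReal.inv_mul_cancel two_ne_zero ENNReal.ofNat_ne_top, one_mul]
  · have hfin : ∀ᵐ t ∂volume.restrict (Icc 0 T), c t ^ 2 < ⊤ := ae_lt_top (hc.pow_const 2)
      (ne_top_of_le_ne_top ENNReal.ofReal_ne_top (henergy 0 T le_rfl hT le_rfl))
    rw [← restrict_Ioc_eq_restrict_Icc] at hfin ⊢
    filter_upwards [hfin, ae_restrict_mem measurableSet_Ioc] with t htop ht
    exact hϕ t ht fun h => by simp [h] at htop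

section Limit

theorem ceil_div_mono {τ : ℝ} (hτ : 0 ≤ τ) : Monotone fun t : ℝ => ⌈t / τ⌉₊ := fun _ _ hst =>
  Nat.ceil_mono (div_le_div_of_nonneg_right hst hτ)

theorem le_ceil_div_mul {τ : ℝ} (hτ : 0 < τ) (t : ℝ) : t ≤ ⌈t / τ⌉₊ * τ :=
  (div_le_iff₀ hτ).1 (Nat.le_ceil _)

theorem ceil_div_mul_le {τ t : ℝ} (hτ : 0 < τ) (ht : 0 ≤ t) : ⌈t / τ⌉₊ * τ ≤ t + τ := by
  have hceil := mul_le_mul_of_nonneg_right (Nat.ceil_lt_add_one (div_nonneg ht hτ.le)).le hτ.le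
  rwa [add_one_mul, div_mul_cancel₀ _ hτ.ne'] at hceil

variable {τ : ℕ → ℝ}

theorem tendsto_ceil_div_mul (hτ : ∀ n, 0 < τ n) (hτ0 : Tendsto τ atTop (𝓝 0)) {t : ℝ}
    (ht : 0 ≤ t) : Tendsto (fun n => (⌈t / τ n⌉₊ : ℝ) * τ n) atTop (𝓝 t) :=
  tendsto_of_tendsto_of_tendsto_of_le_of_le tendsto_const_nhds
    (h := fun n => t + τ n) (by simpa using tendsto_const_nhds.add hτ0)
    (fun n => le_ceil_div_mul (hτ n) t) fun n => ceil_div_mul_le (hτ n) ht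

theorem setLIntegral_liminf_sq_le {c : ℕ → ℝ → ℝ≥0∞} (hc : ∀ n, Measurable (c n)) {s t : ℝ}
    {a b : ℕ → ℝ} (ha : Tendsto a atTop (𝓝 s)) (hb : ∀ n, t ≤ b n) :
    ∫⁻ r in Icc s t, liminf (fun n => c n r) atTop ^ 2 ≤
      liminf (fun n => ∫⁻ r in Ioc (a n) (b n), c n r ^ 2) atTop := by
  have hsq : ∀ r, liminf (fun n => c n r) atTop ^ 2 = liminf (fun n => c n r ^ 2) atTop :=
    fun r => (pow_left_mono 2).map_liminf_of_continuousAt (f := fun x : ℝ≥0∞ => x ^ 2) _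
      (ENNReal.continuous_pow 2).continuousAt
  rw [← restrict_Ioc_eq_restrict_Icc]
  calc ∫⁻ r in Ioc s t, liminf (fun n => c n r) atTop ^ 2
      ≤ ∫⁻ r in Ioc s t,
          liminf (fun n => (Ioc (a n) (b n)).indicator (fun r => c n r ^ 2) r) atTop := by
        refine setLIntegral_mono' measurableSet_Ioc fun r hr => ?_
        rw [hsq]
        refine liminf_le_liminf ?_
        filter_upwards [ha.eventually (gt_mem_nhds hr.1)] with n hn
        rw [indicator_of_mem (show r ∈ Ioc (a n) (b n) from ⟨hn, hr.2.trans (hb n)⟩)]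
    _ ≤ liminf (fun n => ∫⁻ r in Ioc s t,
          (Ioc (a n) (b n)).indicator (fun r => c n r ^ 2) r) atTop :=
        lintegral_liminf_le fun n => ((hc n).pow_const 2).indicator measurableSet_Ioc
    _ ≤ liminf (fun n => ∫⁻ r in Ioc (a n) (b n), c n r ^ 2) atTop :=
        liminf_le_liminf (Eventually.of_forall fun n =>
          (setLIntegral_le_lintegral _ _).trans_eq (lintegral_indicator measurableSet_Ioc _))

variable {w : ℕ → ℕ → X} {u : ℝ → X} {G : ℝ → ℝ} {S : Set ℝ}

theorem hasActionBoundOn_of_tendsto (hτ : ∀ n, 0 < τ n) (hτ0 : Tendsto τ atTop (𝓝 0))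
    (hS : ∀ t ∈ S, 0 ≤ t)
    (hu : ∀ t ∈ S, Tendsto (fun n => piecewiseConst (τ n) (w n) t) atTop (𝓝 (u t)))
    (hG : ∀ t ∈ S, Tendsto (fun n => discreteAction (τ n) (w n) ⌈t / τ n⌉₊) atTop (𝓝 (G t))) :
    HasActionBoundOn u G S where
  monotoneOn s hs t ht hst := le_of_tendsto_of_tendsto' (hG s hs) (hG t ht) fun n =>
    monotone_discreteAction (hτ n).le (w n) (ceil_div_mono (hτ n).le hst)
  sq_dist_le s hs t ht hst := le_of_tendsto_of_tendsto' (((hu s hs).dist (hu t ht)).pow 2)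
    (((tendsto_ceil_div_mul hτ hτ0 (hS t ht)).sub (tendsto_ceil_div_mul hτ hτ0 (hS s hs))).mul
      ((hG t ht).sub (hG s hs)))
    fun n => sq_dist_le_discreteAction (hτ n) (w n) (ceil_div_mono (hτ n).le hst)

theorem tendsto_of_isVariationalInterpolation {φ : ℕ → X → EReal} {f : ℕ → ℕ → ℝ}
    {Z : ℕ → ℝ → X} {c : ℕ → ℝ → ℝ≥0∞}
    (hZ : ∀ n, IsVariationalInterpolation (φ n) (τ n) (w n) (f n) (Z n) (c n))
    (hτ0 : Tendsto τ atTop (𝓝 0)) {t K : ℝ} {x : X} (ht : 0 < t)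
    (hx : Tendsto (fun n => piecewiseConst (τ n) (w n) t) atTop (𝓝 x))
    (hK : Tendsto (fun n => discreteAction (τ n) (w n) ⌈t / τ n⌉₊) atTop (𝓝 K)) :
    Tendsto (fun n => Z n t) atTop (𝓝 x) := by
  have hlim : Tendsto (fun n => √(4 * τ n * discreteAction (τ n) (w n) ⌈t / τ n⌉₊)) atTop
      (𝓝 0) := by
    simpa using ((hτ0.const_mul 4).mul hK).sqrt
  exact (tendsto_iff_of_dist (squeeze_zero (fun n => dist_nonneg)
    (fun n => Real.le_sqrt_of_sq_le ((hZ n).sq_dist_le t ht)) hlim)).2 hx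

theorem GammaConverges.isCurveOfMaximalSlope_of_tendsto {φ : ℝ → X → EReal} {φ₀ : X → EReal}
    (hΓ : GammaConverges φ φ₀) {e : ℕ → ℝ} (he : ∀ n, 0 < e n) (he0 : Tendsto e atTop (𝓝 0))
    (hcone : ∀ n, SlopeConeProperty (φ (e n))) (hτ : ∀ n, 0 < τ n)
    (hτ0 : Tendsto τ atTop (𝓝 0)) {p : ℕ → X}
    (hw : ∀ n, IsDiscreteSolution (φ (e n)) (τ n) (p n) (w n)) {f : ℕ → ℕ → ℝ}
    (hf : ∀ n i, φ (e n) (w n i) = f n i) {Z : ℕ → ℝ → X} {c : ℕ → ℝ → ℝ≥0∞}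
    (hZ : ∀ n, IsVariationalInterpolation (φ (e n)) (τ n) (w n) (f n) (Z n) (c n))
    {T : ℝ} (hT : 0 ≤ T) {ϕ : ℝ → ℝ}
    (hu : ∀ t ∈ Icc 0 T, Tendsto (fun n => piecewiseConst (τ n) (w n) t) atTop (𝓝 (u t)))
    (hϕ : ∀ t ∈ Icc 0 T, Tendsto (fun n => f n ⌈t / τ n⌉₊) atTop (𝓝 (ϕ t)))
    (hG : ∀ t ∈ Icc 0 T,
      Tendsto (fun n => discreteAction (τ n) (w n) ⌈t / τ n⌉₊) atTop (𝓝 (G t))) :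
    IsCurveOfMaximalSlope φ₀ T u := by
  have hΨ : ∀ t ∈ Icc 0 T, Tendsto (fun n =>
      2 * f n ⌈t / τ n⌉₊ + discreteAction (τ n) (w n) ⌈t / τ n⌉₊) atTop (𝓝 (2 * ϕ t + G t)) :=
    fun t ht => ((hϕ t ht).const_mul 2).add (hG t ht)
  have hZu : ∀ t ∈ Ioc 0 T, Tendsto (fun n => Z n t) atTop (𝓝 (u t)) := fun t ht =>
    have htI := Ioc_subset_Icc_self ht
    tendsto_of_isVariationalInterpolation hZ hτ0 ht.1 (hu t htI) (hG t htI)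
  refine isCurveOfMaximalSlope_of_hasActionBoundOn (ϕ := ϕ)
    (c := fun t => liminf (fun n => c n t) atTop) hT
    (hasActionBoundOn_of_tendsto hτ hτ0 (fun t ht => ht.1) hu hG) (fun s hs t ht hst => ?_)
    (Measurable.liminf fun n => (hZ n).measurable) (fun t ht => ?_) (fun t ht hfin => ?_)
    fun s t hs hst ht => ?_
  · exact le_of_tendsto_of_tendsto' (hΨ t ht) (hΨ s hs) fun n =>
      (hw n).antitone_energy_add_discreteAction (hf n) (ceil_div_mono (hτ n).le hst)
  · have htI := Ioc_subset_Icc_self ht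
    exact hΓ.descSlope_le he he0 hcone (hZu t ht) (fun n => (hZ n).ne_top t ht.1) (hu t htI)
      (fun n => hf n _) (fun n => (hZ n).energy_le t ht.1) (hϕ t htI)
      (fun n => (hZ n).descSlope_le t ht.1)
  · have htI := Ioc_subset_Icc_self ht
    exact hΓ.eq_of_tendsto he he0 hcone (hZu t ht) (fun n => (hZ n).ne_top t ht.1) (hu t htI)
      (fun n => hf n _) (fun n => (hZ n).energy_le t ht.1) (hϕ t htI)
      (fun n => (hZ n).descSlope_le t ht.1) hfin
  · refine (setLIntegral_liminf_sq_le (fun n => (hZ n).measurable)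
      (tendsto_ceil_div_mul hτ hτ0 hs) fun n => le_ceil_div_mul (hτ n) t).trans ?_
    rw [← (ENNReal.tendsto_ofReal ((hΨ s ⟨hs, hst.trans ht⟩).sub
      (hΨ t ⟨hs.trans hst, ht⟩))).liminf_eq]
    exact liminf_le_liminf (Eventually.of_forall fun n =>
      (hZ n).lintegral_le _ _ (ceil_div_mono (hτ n).le hst))

end Limit

section MinimizingMovement

theorem IsDiscreteSolution.sub_exp_mul_le_energy_of_le {φ : X → EReal} {τ τstar : ℝ} {p ustar : X}
    {w : ℕ → X} {f : ℕ → ℝ} {Cstar S S' R : ℝ} (hw : IsDiscreteSolution φ τ p w) (hτ : 0 < τ)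
    (hτstar : τ ≤ τstar / 4) (hf : ∀ i, φ (w i) = f i)
    (hbound : ∀ v : X, (Cstar : EReal) ≤ φ v + ((dist v ustar ^ 2 / (2 * τstar) : ℝ) : EReal))
    (hp : φ p ≤ (S : EReal)) (hp' : dist p ustar ^ 2 ≤ S') {i : ℕ} (hi : i * τ ≤ R) :
    Cstar - (S + S' / τstar - Cstar) * Real.exp (8 * R / τstar) ≤ f i := by
  have hτstar0 : 0 < τstar := by linarith
  have hbound' : ∀ i, Cstar ≤ f i + dist (w i) ustar ^ 2 / (2 * τstar) := fun i => by
    simpa [hf, ← EReal.coe_add] using hbound (w i)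
  refine le_trans (sub_le_sub_left ?_ _) (hw.sub_exp_mul_le_energy hτ hτstar hf hbound' i)
  have hS : f 0 ≤ S := by rwa [← EReal.coe_le_coe_iff, ← hf, hw.1]
  have hS' : dist (w 0) ustar ^ 2 / τstar ≤ S' / τstar :=
    div_le_div_of_nonneg_right (hw.1 ▸ hp') hτstar0.le
  have hnonneg : 0 ≤ f 0 + dist (w 0) ustar ^ 2 / τstar - Cstar := by
    have : dist (w 0) ustar ^ 2 / (2 * τstar) ≤ dist (w 0) ustar ^ 2 / τstar := by
      gcongr
      linarith
    linarith [hbound' 0]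
  refine mul_le_mul (by linarith) (Real.exp_le_exp.2 ?_) (Real.exp_pos _).le (by linarith)
  gcongr

variable {τ : ℕ → ℝ} {p : ℕ → X} {w : ℕ → ℕ → X} {f : ℕ → ℕ → ℝ} {T S L : ℝ}

theorem exists_subseq_tendsto_energy_and_discreteAction {φ : ℕ → X → EReal} (hτ : ∀ n, 0 < τ n)
    (hw : ∀ n, IsDiscreteSolution (φ n) (τ n) (p n) (w n)) (hf : ∀ n i, φ n (w n i) = f n i)
    (hT : 0 ≤ T) (hS : ∀ n, f n 0 ≤ S) (hL : ∀ n, ∀ t ∈ Icc 0 T, L ≤ f n ⌈t / τ n⌉₊) :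
    ∃ σ : ℕ → ℕ, StrictMono σ ∧ ∃ ϕ G : ℝ → ℝ, ∀ t ∈ Icc 0 T,
      Tendsto (fun n => f (σ n) ⌈t / τ (σ n)⌉₊) atTop (𝓝 (ϕ t)) ∧
      Tendsto (fun n => discreteAction (τ (σ n)) (w (σ n)) ⌈t / τ (σ n)⌉₊) atTop (𝓝 (G t)) := by
  have hfS : ∀ n i, f n i ≤ S := fun n i =>
    ((hw n).antitone_energy (hτ n).le (hf n) i.zero_le).trans (hS n)
  have hK_nonneg : ∀ n i, 0 ≤ discreteAction (τ n) (w n) i := fun n i => by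
    simpa [discreteAction] using monotone_discreteAction (hτ n).le (w n) i.zero_le
  have hK_le : ∀ n, ∀ t ∈ Icc 0 T, discreteAction (τ n) (w n) ⌈t / τ n⌉₊ ≤ 2 * (S - L) :=
    fun n t ht => by
      have := (hw n).antitone_energy_add_discreteAction (hf n) (Nat.zero_le ⌈t / τ n⌉₊)
      simp only [discreteAction, Finset.range_zero, Finset.sum_empty] at this ⊢
      linarith [hS n, hL n t ht]
  obtain ⟨σ, hσ, ϕ, hϕ⟩ := exists_subseq_tendsto_of_antitoneOn_Icc hT
    (f := fun n t => f n ⌈t / τ n⌉₊) (C := max |L| |S|)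
    (fun n => (((hw n).antitone_energy (hτ n).le (hf n)).comp_monotone
      (ceil_div_mono (hτ n).le)).antitoneOn _)
    fun n t ht => abs_le_max_abs_abs (hL n t ht) (hfS n _)
  obtain ⟨ρ, hρ, G, hG⟩ := exists_subseq_tendsto_of_antitoneOn_Icc hT
    (f := fun n t => -discreteAction (τ (σ n)) (w (σ n)) ⌈t / τ (σ n)⌉₊) (C := 2 * (S - L))
    (fun n => ((monotone_discreteAction (hτ _).le (w _)).comp
      (ceil_div_mono (hτ _).le)).neg.antitoneOn _)
    fun n t ht => by rw [abs_neg, abs_of_nonneg (hK_nonneg _ _)]; exact hK_le _ t ht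
  exact ⟨σ ∘ ρ, hσ.comp hρ, ϕ, fun t => -G t, fun t ht =>
    ⟨(hϕ t ht).comp hρ.tendsto_atTop, by simpa using (hG t ht).neg⟩⟩

theorem GammaConverges.isCurveOfMaximalSlope_of_le_energy {φ : ℝ → X → EReal} {φ₀ : X → EReal}
    (hΓ : GammaConverges φ φ₀) {e : ℕ → ℝ} (he : ∀ n, 0 < e n) (he0 : Tendsto e atTop (𝓝 0))
    (hbot : ∀ n x, φ (e n) x ≠ ⊥) (hcone : ∀ n, SlopeConeProperty (φ (e n)))
    (hτ : ∀ n, 0 < τ n) (hτ0 : Tendsto τ atTop (𝓝 0))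
    (hw : ∀ n, IsDiscreteSolution (φ (e n)) (τ n) (p n) (w n))
    (hf : ∀ n i, φ (e n) (w n i) = f n i)
    (hex : ∀ n i, ∀ r ∈ Ioc 0 (τ n), ∃ v, IsProxStep (φ (e n)) r (w n i) v)
    (hT : 0 ≤ T) (hS : ∀ n, f n 0 ≤ S) (hL : ∀ n, ∀ t ∈ Icc 0 T, L ≤ f n ⌈t / τ n⌉₊) {u : ℝ → X}
    (hu : ∀ t ∈ Icc 0 T, Tendsto (fun n => piecewiseConst (τ n) (w n) t) atTop (𝓝 (u t))) :
    IsCurveOfMaximalSlope φ₀ T u := by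
  obtain ⟨σ, hσ, ϕ, G, hϕG⟩ := exists_subseq_tendsto_energy_and_discreteAction hτ hw hf hT hS hL
  choose Z c hZ using fun n =>
    (hw n).exists_isVariationalInterpolation (hτ n) (hbot n) (hf n) (hex n)
  have hσ_top := hσ.tendsto_atTop
  exact hΓ.isCurveOfMaximalSlope_of_tendsto (fun n => he (σ n)) (he0.comp hσ_top)
    (fun n => hcone (σ n)) (fun n => hτ (σ n)) (hτ0.comp hσ_top) (fun n => hw (σ n))
    (fun n => hf (σ n)) (fun n => hZ (σ n)) hT (fun t ht => (hu t ht).comp hσ_top)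
    (fun t ht => (hϕG t ht).1) (fun t ht => (hϕG t ht).2)

theorem IsMinimizingMovement.exists_seq {φ : ℝ → X → EReal} {τ : ℝ → ℝ} {u₀ u : ℝ → X}
    (hu : IsMinimizingMovement φ τ u₀ u) (hτ0 : Tendsto τ (𝓝[>] 0) (𝓝 0)) {δ : ℝ} (hδ : 0 < δ) :
    ∃ (e : ℕ → ℝ) (w : ℕ → ℕ → X), (∀ n, 0 < e n) ∧ Tendsto e atTop (𝓝 0) ∧
      Tendsto (τ ∘ e) atTop (𝓝 0) ∧ (∀ n, τ (e n) ≤ δ) ∧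
      (∀ n, IsDiscreteSolution (φ (e n)) (τ (e n)) (u₀ (e n)) (w n)) ∧
      ∀ t, 0 ≤ t → Tendsto (fun n => piecewiseConst (τ (e n)) (w n) t) atTop (𝓝 (u t)) := by
  obtain ⟨w, hw, e, he, he0, hlim⟩ := hu
  have he0' : Tendsto e atTop (𝓝[>] 0) :=
    tendsto_nhdsWithin_iff.2 ⟨he0, Eventually.of_forall he⟩
  obtain ⟨N, hN⟩ := eventually_atTop.1
    (he0'.eventually (hw.and (hτ0.eventually (ge_mem_nhds hδ))))
  have hadd : Tendsto (fun n => n + N) atTop atTop := tendsto_add_atTop_nat N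
  exact ⟨fun n => e (n + N), fun n => w (e (n + N)), fun n => he _, he0.comp hadd,
    (hτ0.comp he0').comp hadd, fun n => (hN _ (N.le_add_left n)).2,
    fun n => (hN _ (N.le_add_left n)).1, fun t ht => (hlim t ht).comp hadd⟩

end MinimizingMovement

end MetricSpace

theorem corollary1_general {X : Type*} [MetricSpace X] (φ : ℝ → X → EReal) (φ₀ : X → EReal)
    (ustar : X) (hbot : ∀ ε : ℝ, 0 < ε → ∀ x, φ ε x ≠ ⊥)
    (hlsc : ∀ ε : ℝ, 0 < ε → LowerSemicontinuous (φ ε))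
    (hbound : ∃ Cstar τstar : ℝ, 0 < τstar ∧ ∀ ε : ℝ, 0 < ε → ∀ v : X,
      (Cstar : EReal) ≤ φ ε v + ((dist v ustar ^ 2 / (2 * τstar) : ℝ) : EReal))
    (hcompact : ∀ ε : ℝ, 0 < ε → ∀ C : ℝ, 0 < C → ∃ K : Set X, IsCompact K ∧
      {v : X | dist v ustar ^ 2 ≤ C ∧ ((-C : ℝ) : EReal) ≤ φ ε v ∧ φ ε v ≤ (C : EReal)} ⊆ K)
    (hGamma : GammaConverges φ φ₀) :
    ((∀ ε : ℝ, 0 < ε → SlopeConeProperty (φ ε)) →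
      ∀ (u₀ : ℝ → X) (S S' : ℝ),
        (∀ ε : ℝ, 0 < ε → dist (u₀ ε) ustar ^ 2 ≤ S') →
        (∀ ε : ℝ, 0 < ε → φ ε (u₀ ε) ≤ (S : EReal)) →
        ∀ τ : ℝ → ℝ, (∀ ε : ℝ, 0 < ε → 0 < τ ε) → Tendsto τ (𝓝[>] 0) (𝓝 0) →
          ∀ u : ℝ → X, IsMinimizingMovement φ τ u₀ u →
            ∀ T : ℝ, 0 < T → IsCurveOfMaximalSlope φ₀ T u) ∧
    (∀ ψ : X → EReal, (∀ x, ψ x ≠ ⊥) → IsGeodesicallyConvex ψ → SlopeConeProperty ψ) := by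
  obtain ⟨Cstar, τstar, hτstar, hbound⟩ := hbound
  refine ⟨fun hcone u₀ S S' hS' hS τ hτ hτ0 u hu T hT => ?_,
    fun ψ hψ hconv => hconv.slopeConeProperty hψ⟩
  obtain ⟨e, w, he, he0, hτe0, hτe, hw, hlim⟩ := hu.exists_seq hτ0 (div_pos hτstar four_pos)
  choose f hf using fun n => (hw n).exists_energy (hbot _ (he n))
    (ne_top_of_le_ne_top (EReal.coe_ne_top S) (hS _ (he n)))
  set R : ℝ := T + τstar / 4
  refine hGamma.isCurveOfMaximalSlope_of_le_energy (S := S)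
    (L := Cstar - (S + S' / τstar - Cstar) * Real.exp (8 * R / τstar)) he he0
    (fun n => hbot _ (he n)) (fun n => hcone _ (he n)) (fun n => hτ _ (he n)) hτe0 hw hf
    (fun n i r hr => ?_) hT.le (fun n => ?_) (fun n t ht => ?_) fun t ht => hlim t ht.1
  · exact exists_isProxStep (hlsc _ (he n)) (hbot _ (he n)) hτstar (hbound _ (he n))
      (hcompact _ (he n)) (by simp [hf]) hr.1 (hr.2.trans (hτe n))
  · simpa [← (hw n).1, hf] using hS _ (he n)
  · refine (hw n).sub_exp_mul_le_energy_of_le (hτ _ (he n)) (hτe n) (hf n) (hbound _ (he n))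
      (hS _ (he n)) (hS' _ (he n)) ?_
    exact (ceil_div_mul_le (hτ _ (he n)) ht.1).trans (add_le_add ht.2 (hτe n))

theorem corollary1 {X : Type*} [MetricSpace X] [CompleteSpace X]
    (φ : ℝ → X → EReal) (φ₀ : X → EReal) (ustar : X)
    -- `φ ε` takes values in `(-∞, +∞]`
    (hbot : ∀ ε : ℝ, 0 < ε → ∀ x, φ ε x ≠ ⊥)
    -- (i)
    (hlsc : ∀ ε : ℝ, 0 < ε → LowerSemicontinuous (φ ε))
    -- (ii)
    (hbound : ∃ Cstar τstar : ℝ, 0 < τstar ∧ ∀ ε : ℝ, 0 < ε → ∀ v : X,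
      (Cstar : EReal) ≤ φ ε v + ((dist v ustar ^ 2 / (2 * τstar) : ℝ) : EReal))
    -- (iii)
    (hcompact : ∀ C : ℝ, 0 < C → ∃ K : Set X, IsCompact K ∧ ∀ ε : ℝ, 0 < ε →
      {v : X | dist v ustar ^ 2 ≤ C ∧ ((-C : ℝ) : EReal) ≤ φ ε v ∧ φ ε v ≤ (C : EReal)} ⊆ K)
    (hGamma : GammaConverges φ φ₀) :
    ((∀ ε : ℝ, 0 < ε → SlopeConeProperty (φ ε)) →
      ∀ (u₀ : ℝ → X) (S S' : ℝ),
        (∀ ε : ℝ, 0 < ε → dist (u₀ ε) ustar ^ 2 ≤ S') →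
        (∀ ε : ℝ, 0 < ε → ((-S : ℝ) : EReal) ≤ φ ε (u₀ ε) ∧ φ ε (u₀ ε) ≤ (S : EReal)) →
        ∀ τ : ℝ → ℝ, (∀ ε : ℝ, 0 < ε → 0 < τ ε) → Tendsto τ (𝓝[>] 0) (𝓝 0) →
          ∀ u : ℝ → X, IsMinimizingMovement φ τ u₀ u →
            ∀ T : ℝ, 0 < T → IsCurveOfMaximalSlope φ₀ T u) ∧
    -- convex functions have the Slope Cone Property, so the above applies to them
    (∀ ψ : X → EReal, (∀ x, ψ x ≠ ⊥) → IsGeodesicallyConvex ψ → SlopeConeProperty ψ) := by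
  refine (corollary1_general φ φ₀ ustar hbot hlsc hbound (fun ε hε C hC => ?_) hGamma).imp_left
    fun h hcone u₀ S S' hS' hS => h hcone u₀ S S' hS' fun ε hε => (hS ε hε).2
  exact (hcompact C hC).imp fun _ hK => ⟨hK.1, hK.2 ε hε⟩
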